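/- Let $\Sigma$ be a rational polyhedral fan in $\mathbb{Q}^3$, that is, a nonempty finite collection of strongly convex rational polyhedral cones, closed under taking faces, any two of which meet in a common face. Assume that $\Sigma$ is three-dimensional and hereditary: for every cone $\sigma\in\Sigma$ the dual graph of the star of $\sigma$ (vertices: the 3-dimensional cones containing $\sigma$; edges: pairs sharing a 2-dimensional face) is nonempty and connected. A boundary cone is a face of a 2-dimensional cone that lies in exactly one 3-dimensional cone; all other cones are interior. Let $f_3$ be the number of 3-dimensional cones and $f_i^0$ the number of interior $i$-dimensional cones. Let $C^0(\Sigma)$ be the graded $\mathbb{Q}[x_1,x_2,x_3]$-module of $C^0$-splines: families of polynomials $(p_\sigma)$, one for each 3-dimensional cone $\sigma$, such that $p_\sigma$ and $p_{\sigma'}$ agree on $\tau$ whenever $\tau$ is a common 2-dimensional face of $\sigma$ and $\sigma'$. For a line $\xi\subset\mathbb{Q}^3$ through the origin let $G_\xi(\Sigma)$ be the graph whose vertices are the interior 2-dimensional cones $\beta$ with $\xi\subseteq\operatorname{span}\beta$, where two distinct vertices $\beta,\beta'$ are joined by an edge if they are facets of a common 3-dimensional cone of $\Sigma$ and $\xi=\operatorname{span}\beta\cap\operatorname{span}\beta'$.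 Then $\operatorname{rank}H_1(G_\xi(\Sigma),\mathbb{Z})$ is nonzero for only finitely many $\xi$, and with $$\alpha_1=\Big(\sum_{\xi}\operatorname{rank}H_1(G_\xi(\Sigma),\mathbb{Z})\Big)-f_1^0$$ the Hilbert polynomial of $C^0(\Sigma)$ (the polynomial in $k$ that equals $\dim_{\mathbb{Q}}C^0(\Sigma)_k$ for all large $k$) is $$HP(C^0(\Sigma),k)=f_3\binom{k+2}{2}-f_2^0\,(k+1)+f_1^0+\alpha_1 .$$ -/

import Mathlib

noncomputable section

/-! ### Rational polyhedral fans

A finitely generated `PointedCone ℚ (Fin d → ℚ)` (in Mathlib, "pointed" only means `0 ∈ σ`) is the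
same thing as a rational polyhedral cone. -/

/-- The linear span of a cone. -/
def coneSpan {d : ℕ} (σ : PointedCone ℚ (Fin d → ℚ)) : Submodule ℚ (Fin d → ℚ) :=
  Submodule.span ℚ (σ : Set (Fin d → ℚ))

/-- The dimension of a cone is the dimension of its linear span. -/
def coneDim {d : ℕ} (σ : PointedCone ℚ (Fin d → ℚ)) : ℕ :=
  Module.finrank ℚ (coneSpan σ)

/-- A rational polyhedral fan in `ℚ^d`: a nonempty finite collection of strongly convex
finitely generated cones, closed under taking faces, any two of which meet in a common face. -/
structure PolyhedralFan (d : ℕ) where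
  cones : Finset (PointedCone ℚ (Fin d → ℚ))
  nonempty : cones.Nonempty
  fg : ∀ σ ∈ cones, Submodule.FG σ
  lineal_eq_bot : ∀ σ ∈ cones, σ.lineal = ⊥
  face_mem : ∀ σ ∈ cones, ∀ τ : PointedCone ℚ (Fin d → ℚ), τ.IsFaceOf σ → τ ∈ cones
  inter_isFaceOf : ∀ σ ∈ cones, ∀ τ ∈ cones, (σ ⊓ τ).IsFaceOf σ ∧ (σ ⊓ τ).IsFaceOf τ

namespace PolyhedralFan

variable {d : ℕ}

/-- The set of `i`-dimensional cones of the fan. -/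
def faces (F : PolyhedralFan d) (i : ℕ) : Set (PointedCone ℚ (Fin d → ℚ)) :=
  {σ | σ ∈ F.cones ∧ coneDim σ = i}

/-- The number `f_i` of `i`-dimensional cones. -/
def numFaces (F : PolyhedralFan d) (i : ℕ) : ℕ := (F.faces i).ncard

/-- The dual graph of the star of a cone `σ`: its vertices are the `d`-dimensional cones that
contain `σ`, and two of them are adjacent when they share a `(d-1)`-dimensional face. -/
def starDualGraph (F : PolyhedralFan d) (σ : PointedCone ℚ (Fin d → ℚ)) :
    SimpleGraph {α : PointedCone ℚ (Fin d → ℚ) // α ∈ F.faces d ∧ σ.IsFaceOf α} where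
  Adj α α' := α ≠ α' ∧ ∃ τ ∈ F.cones, coneDim τ + 1 = d ∧ τ.IsFaceOf α.1 ∧ τ.IsFaceOf α'.1
  symm := ⟨fun _ _ h => ⟨h.1.symm, by
    obtain ⟨-, τ, h1, h2, h3, h4⟩ := h
    exact ⟨τ, h1, h2, h4, h3⟩⟩⟩
  loopless := ⟨fun _ h => h.1 rfl⟩

/-- A fan is hereditary if the star of each of its cones has a connected dual graph. A connected
graph has a vertex, so every cone of a hereditary fan is a face of some `d`-dimensional cone. -/
def IsHereditary (F : PolyhedralFan d) : Prop :=
  ∀ σ ∈ F.cones, (F.starDualGraph σ).Connected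

/-- The boundary of the fan is generated by the `(d-1)`-dimensional cones that are a face of exactly
one `d`-dimensional cone; `σ` is a boundary cone if it is a face of one of these. -/
def IsBoundary (F : PolyhedralFan d) (σ : PointedCone ℚ (Fin d → ℚ)) : Prop :=
  ∃ τ ∈ F.cones, coneDim τ + 1 = d ∧ (∃! α, α ∈ F.faces d ∧ τ.IsFaceOf α) ∧ σ.IsFaceOf τ

/-- The set of interior `i`-dimensional cones. -/
def interiorFaces (F : PolyhedralFan d) (i : ℕ) : Set (PointedCone ℚ (Fin d → ℚ)) :=
  {σ | σ ∈ F.faces i ∧ ¬ F.IsBoundary σ}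

/-- The number `f_i^0` of interior `i`-dimensional cones. -/
def numInteriorFaces (F : PolyhedralFan d) (i : ℕ) : ℕ := (F.interiorFaces i).ncard

/-! ### The module of `C^0`-splines and its Hilbert polynomial -/

/-- The module `C^0(Σ)` of `C^0`-splines over the polynomial ring: families of polynomials, one for
each `d`-dimensional cone, such that the polynomials on two cones which share a
`(d-1)`-dimensional face `τ` agree on `τ`. -/
def splines (F : PolyhedralFan d) :
    Submodule (MvPolynomial (Fin d) ℚ) (F.faces d → MvPolynomial (Fin d) ℚ) where
  carrier := {p | ∀ α α' : F.faces d, ∀ τ ∈ F.cones, coneDim τ + 1 = d →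
    τ.IsFaceOf α.1 → τ.IsFaceOf α'.1 →
      ∀ x ∈ τ, MvPolynomial.eval x (p α) = MvPolynomial.eval x (p α')}
  add_mem' := by
    intro p q hp hq α α' τ hτ hd h1 h2 x hx
    simp [hp α α' τ hτ hd h1 h2 x hx, hq α α' τ hτ hd h1 h2 x hx]
  zero_mem' := by
    intro α α' τ hτ hd h1 h2 x hx
    simp
  smul_mem' := by
    intro c p hp α α' τ hτ hd h1 h2 x hx
    simp [hp α α' τ hτ hd h1 h2 x hx]

/-- The degree `k` part of `C^0(Σ)`: the splines all of whose components are homogeneous of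
degree `k`. -/
def splinesOfDegree (F : PolyhedralFan d) (k : ℕ) :
    Submodule ℚ (F.faces d → MvPolynomial (Fin d) ℚ) :=
  F.splines.restrictScalars ℚ ⊓
    Submodule.pi Set.univ (fun _ => MvPolynomial.homogeneousSubmodule (Fin d) ℚ k)

/-- `P` is the Hilbert polynomial of `C^0(Σ)`: it takes the value `dim_ℚ C^0(Σ)_k` at every
sufficiently large `k`. -/
def IsHilbertPolynomial (F : PolyhedralFan d) (P : Polynomial ℚ) : Prop :=
  ∀ᶠ k : ℕ in Filter.atTop, (Module.finrank ℚ (F.splinesOfDegree k) : ℚ) = P.eval (k : ℚ)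

end PolyhedralFan

/-! ### First homology of a graph -/

/-- The group of simplicial 1-chains of a graph: an oriented edge from `v` to `w` is the negative of
the oriented edge from `w` to `v`, so a chain is an antisymmetric integer function on ordered pairs
of vertices that vanishes off the edges. -/
def graphOneChains {V : Type*} (G : SimpleGraph V) : Submodule ℤ (V → V → ℤ) where
  carrier := {c | (∀ v w, c w v = -c v w) ∧ ∀ v w, ¬ G.Adj v w → c v w = 0}
  add_mem' := by
    rintro a b ⟨ha, ha'⟩ ⟨hb, hb'⟩
    refine ⟨fun v w => ?_, fun v w h => ?_⟩
    · simp only [Pi.add_apply, ha v w, hb v w]; ring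
    · simp [ha' v w h, hb' v w h]
  zero_mem' := by simp
  smul_mem' := by
    rintro n a ⟨ha, ha'⟩
    refine ⟨fun v w => ?_, fun v w h => ?_⟩
    · simp [ha v w]
    · simp [ha' v w h]

/-- The boundary map `∂ : C_1 → C_0`, which sends the oriented edge from `v` to `w` to `w - v`. -/
def graphBoundary {V : Type*} [Fintype V] (G : SimpleGraph V) :
    graphOneChains G →ₗ[ℤ] (V → ℤ) where
  toFun c := fun w => ∑ v, c.1 v w
  map_add' a b := by
    funext w
    simp [Finset.sum_add_distrib]
  map_smul' n a := by
    funext w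
    simp [Finset.mul_sum]

/-- The first Betti number `rank H_1(G, ℤ)`; a graph has no 2-chains, so `H_1` is the kernel
of `∂ : C_1 → C_0`. -/
def graphBettiOne {V : Type*} [Fintype V] (G : SimpleGraph V) : ℕ :=
  Module.finrank ℤ (LinearMap.ker (graphBoundary G))

namespace PolyhedralFan

variable {d : ℕ}

/-! ### The graphs `G_ξ(Σ)` -/

/-- The vertices of `G_ξ(Σ)`, for `ξ` of codimension `i + 1` in `ℚ^d`: the interior cones of
codimension `i` whose linear span contains `ξ`. -/
def GraphVertex (F : PolyhedralFan d) (i : ℕ) (ξ : Submodule ℚ (Fin d → ℚ)) : Type :=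
  {β : PointedCone ℚ (Fin d → ℚ) // β ∈ F.interiorFaces (d - i) ∧ ξ ≤ coneSpan β}

instance (F : PolyhedralFan d) (i : ℕ) (ξ : Submodule ℚ (Fin d → ℚ)) :
    Fintype (F.GraphVertex i ξ) :=
  have : Finite (F.GraphVertex i ξ) :=
    (Set.Finite.subset F.cones.finite_toSet (t := {β | β ∈ F.interiorFaces (d - i) ∧ ξ ≤ coneSpan β})
      (fun _ h => h.1.1.1)).to_subtype
  Fintype.ofFinite _

/-- The graph `G_ξ(Σ)`, for `ξ` of codimension `i + 1`: two distinct vertices `β` and `β'` are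
adjacent when they are facets of a common interior cone of codimension `i - 1` and `ξ` is the
intersection of their linear spans. -/
def graph (F : PolyhedralFan d) (i : ℕ) (ξ : Submodule ℚ (Fin d → ℚ)) :
    SimpleGraph (F.GraphVertex i ξ) where
  Adj β β' := β ≠ β' ∧ ξ = coneSpan β.1 ⊓ coneSpan β'.1 ∧
    ∃ α ∈ F.interiorFaces (d - i + 1), β.1.IsFaceOf α ∧ β'.1.IsFaceOf α
  symm := ⟨fun _ _ h => ⟨h.1.symm, by rw [inf_comm]; exact h.2.1, by
    obtain ⟨-, -, α, h1, h2, h3⟩ := h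
    exact ⟨α, h1, h3, h2⟩⟩⟩
  loopless := ⟨fun _ h => h.1 rfl⟩

/-- `rank H_1(G_ξ(Σ), ℤ)` for a linear subspace `ξ` of codimension two. -/
def betti (F : PolyhedralFan d)
    (ξ : {ξ : Submodule ℚ (Fin d → ℚ) // Module.finrank ℚ ξ + 2 = d}) : ℕ :=
  graphBettiOne (F.graph 1 ξ.1)

/-- The integer `α_1`: the sum of `rank H_1(G_ξ(Σ), ℤ)` over all linear subspaces `ξ` of
codimension two, minus `f_{d-2}^0`. -/
def alphaOne (F : PolyhedralFan d) : ℤ :=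
  (∑ᶠ ξ, (F.betti ξ : ℤ)) - F.numInteriorFaces (d - 2)

end PolyhedralFan

end

noncomputable section

open Module

/-! ### Faces, spans and supporting hyperplanes of a single cone. -/

section Cones

variable {d : ℕ}

/-! Let `V` be the space of forms of degree `k`. Choosing for every interior 2-dimensional cone `b`
an order `p b`, `m b` of the two 3-dimensional cones containing it, a spline of degree `k` is a
family in `V`, indexed by the 3-dimensional cones, whose differences across each `b` lie in the
forms vanishing on the plane spanned by `b`, that is, the multiples of a linear form `l_b`.
Rank-nullity (`finrank_comap_add`) gives its dimension as the expected count f₃ dim V − f₂⁰ dim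
V/(l_b) plus an error term: the dimension of the space of functionals on `B → V` that annihilate
both the coboundaries and all multiples of the `l_b`. Since dim V/(l_b) = k + 1, only the error term
needs work.

Such a functional θ has components θ_b, each killing the multiples of `l_b`, whose signed sum over
the interior facets of every maximal cone `s` is zero. If f vanishes on the lines where the plane of
`b` meets the planes of the other interior facets of `s`, then f is a combination of `l_b` and the
product of the other `l_b'`; the zero-sum relation then forces θ_b f = 0
(`functional_eq_zero_of_sum_eq_zero`). Hence θ_b is a combination of evaluations at points spanning
those lines (`comp_single_mem_span`).

In large degree evaluations at finitely many distinct lines are independent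
(`linearIndependent_evalForm`), so θ decouples: for each line ξ its coefficients form a function on
the vertices of G_ξ with zero signed sum at every maximal cone
(`finrank_dualAnnihilator_eq_sum_incidenceKernel`). At most two facets of a maximal cone have spans
containing ξ, so these functions are exactly the 1-cycles of G_ξ over ℚ (`betti_eq_finrank`). The
error term is therefore the sum of the Betti numbers, and f₁⁰ cancels against its copy in α₁. -/

theorem mem_coneSpan_iff {σ : PointedCone ℚ (Fin d → ℚ)} {x : Fin d → ℚ} :
    x ∈ coneSpan σ ↔ ∃ a ∈ σ, ∃ b ∈ σ, x = a - b := by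
  constructor
  · intro hx
    induction hx using Submodule.span_induction with
    | mem x h => exact ⟨x, h, 0, zero_mem _, by simp⟩
    | zero => exact ⟨0, zero_mem _, 0, zero_mem _, by simp⟩
    | add x y _ _ hx hy =>
      obtain ⟨a, ha, b, hb, rfl⟩ := hx
      obtain ⟨a', ha', b', hb', rfl⟩ := hy
      exact ⟨a + a', add_mem ha ha', b + b', add_mem hb hb', by abel⟩
    | smul c x _ hx =>
      obtain ⟨a, ha, b, hb, rfl⟩ := hx
      rcases le_total 0 c with hc | hc
      · exact ⟨c • a, σ.smul_mem hc ha, c • b, σ.smul_mem hc hb, by rw [smul_sub]⟩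
      · refine ⟨(-c) • b, σ.smul_mem (neg_nonneg.2 hc) hb, (-c) • a,
          σ.smul_mem (neg_nonneg.2 hc) ha, ?_⟩
        simp only [neg_smul, smul_sub]; abel
  · rintro ⟨a, ha, b, hb, rfl⟩
    exact sub_mem (Submodule.subset_span ha) (Submodule.subset_span hb)

theorem mem_coneSpan_of_mem {σ : PointedCone ℚ (Fin d → ℚ)} {x : Fin d → ℚ} (hx : x ∈ σ) :
    x ∈ coneSpan σ := Submodule.subset_span hx

theorem coneSpan_mono {σ τ : PointedCone ℚ (Fin d → ℚ)} (h : σ ≤ τ) : coneSpan σ ≤ coneSpan τ :=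
  Submodule.span_mono h

theorem coneSpan_eq_top {σ : PointedCone ℚ (Fin d → ℚ)} (h : coneDim σ = d) :
    coneSpan σ = ⊤ :=
  Submodule.eq_top_of_finrank_eq (by rw [finrank_fin_fun]; exact h)

namespace PointedCone.IsFaceOf

variable {σ τ τ' : PointedCone ℚ (Fin d → ℚ)}

/-- If x = a − b with a, b ∈ τ, then x + b ∈ τ, and the face property puts x in τ. A face is thus
determined by its span. -/
theorem mem_of_mem_coneSpan (h : τ.IsFaceOf σ) {x : Fin d → ℚ} (hx : x ∈ σ)
    (hxτ : x ∈ coneSpan τ) : x ∈ τ := by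
  obtain ⟨a, ha, b, hb, rfl⟩ := mem_coneSpan_iff.1 hxτ
  exact h.mem_of_add_mem_left hx (h.le hb) (by simpa using ha)

theorem eq_of_coneSpan_eq (h : τ.IsFaceOf σ) (h' : τ'.IsFaceOf σ)
    (e : coneSpan τ = coneSpan τ') : τ = τ' :=
  le_antisymm
    (fun _ hx => h'.mem_of_mem_coneSpan (h.le hx) (e ▸ mem_coneSpan_of_mem hx))
    (fun _ hx => h.mem_of_mem_coneSpan (h'.le hx) (e ▸ mem_coneSpan_of_mem hx))

theorem eq_of_coneSpan_eq_top (h : τ.IsFaceOf σ) (e : coneSpan τ = ⊤) : τ = σ :=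
  le_antisymm h.le fun _ hx => h.mem_of_mem_coneSpan hx (e ▸ Submodule.mem_top)

end PointedCone.IsFaceOf

/-- A hyperplane is the kernel of a linear form. -/
theorem exists_ker_eq {H : Submodule ℚ (Fin d → ℚ)} (h : finrank ℚ H + 1 = d) :
    ∃ l : Dual ℚ (Fin d → ℚ), LinearMap.ker l = H := by
  have hH : H < ⊤ := by
    rw [lt_top_iff_ne_top]
    rintro rfl
    rw [finrank_top, finrank_fin_fun] at h
    omega
  obtain ⟨l, hl, hle⟩ := H.exists_le_ker_of_lt_top hH
  refine ⟨l, (Submodule.eq_of_le_of_finrank_le hle ?_).symm⟩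
  have h1 := Submodule.finrank_lt (s := LinearMap.ker l)
    (by rwa [Ne, LinearMap.ker_eq_top])
  rw [finrank_fin_fun] at h1
  omega

/-- If `l` took both signs on σ, a positive combination of two points of opposite sign would lie in
σ ∩ span τ = τ; the face property would put those points in τ, where `l` vanishes. -/
theorem ker_sign_of_isFaceOf {σ τ : PointedCone ℚ (Fin d → ℚ)} (h : τ.IsFaceOf σ)
    {l : Dual ℚ (Fin d → ℚ)} (hl : LinearMap.ker l = coneSpan τ) :
    (∀ x ∈ σ, 0 ≤ l x) ∨ (∀ x ∈ σ, 0 ≤ (-l) x) := by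
  by_contra! hcon
  obtain ⟨⟨x, hx, hlx⟩, y, hy, hly⟩ := hcon
  have hly' : 0 < l y := by simpa using hly
  have hk : l y • x + (-l x) • y ∈ coneSpan τ := by
    rw [← hl, LinearMap.mem_ker]
    simp only [map_add, map_smul, smul_eq_mul]
    ring
  have hs : l y • x + (-l x) • y ∈ σ :=
    add_mem (σ.smul_mem hly'.le hx) (σ.smul_mem (by linarith) hy)
  have := h.mem_of_smul_add_smul_mem_left hx hy hly' (neg_pos.2 hlx)
    (h.mem_of_mem_coneSpan hs hk)
  have h0 : l x = 0 := by
    rw [← LinearMap.mem_ker, hl]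
    exact mem_coneSpan_of_mem this
  linarith

theorem exists_supporting_form {σ τ : PointedCone ℚ (Fin d → ℚ)} (h : τ.IsFaceOf σ)
    (hd : coneDim τ + 1 = d) :
    ∃ l : Dual ℚ (Fin d → ℚ), LinearMap.ker l = coneSpan τ ∧ ∀ x ∈ σ, 0 ≤ l x := by
  obtain ⟨l, hl⟩ := exists_ker_eq hd
  rcases ker_sign_of_isFaceOf h hl with h1 | h1
  · exact ⟨l, hl, h1⟩
  · refine ⟨-l, ?_, h1⟩
    rw [← hl]
    ext x
    simp

theorem coneSpan_le_iff_eq {τ τ' : PointedCone ℚ (Fin d → ℚ)} (e : coneDim τ = coneDim τ') :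
    coneSpan τ ≤ coneSpan τ' ↔ coneSpan τ = coneSpan τ' :=
  ⟨fun h => Submodule.eq_of_le_of_finrank_eq h e, fun h => h.le⟩

/-- At most two facets of a cone have spans containing a given subspace of codimension two. -/
theorem not_three_facets {σ τ₁ τ₂ τ₃ : PointedCone ℚ (Fin d → ℚ)} (h₁ : τ₁.IsFaceOf σ)
    (h₂ : τ₂.IsFaceOf σ) (h₃ : τ₃.IsFaceOf σ) (d₁ : coneDim τ₁ + 1 = d)
    (d₂ : coneDim τ₂ + 1 = d) (d₃ : coneDim τ₃ + 1 = d) (h₁₂ : τ₁ ≠ τ₂) (h₁₃ : τ₁ ≠ τ₃)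
    (h₂₃ : τ₂ ≠ τ₃) {ξ : Submodule ℚ (Fin d → ℚ)} (hξ : finrank ℚ ξ + 2 = d)
    (le₁ : ξ ≤ coneSpan τ₁) (le₂ : ξ ≤ coneSpan τ₂) (le₃ : ξ ≤ coneSpan τ₃) : False := by
  obtain ⟨l₁, k₁, p₁⟩ := exists_supporting_form h₁ d₁
  obtain ⟨l₂, k₂, p₂⟩ := exists_supporting_form h₂ d₂
  obtain ⟨l₃, k₃, p₃⟩ := exists_supporting_form h₃ d₃
  have pos : ∀ {τ τ' : PointedCone ℚ (Fin d → ℚ)} {l : Dual ℚ (Fin d → ℚ)}, τ.IsFaceOf σ →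
      τ'.IsFaceOf σ → coneDim τ + 1 = d → coneDim τ' + 1 = d → τ ≠ τ' →
      LinearMap.ker l = coneSpan τ' → (∀ x ∈ σ, 0 ≤ l x) → ∃ x ∈ τ, 0 < l x := by
    intro τ τ' l h h' dt dt' hne hk hp
    by_contra! hcon
    refine hne (h.eq_of_coneSpan_eq h' ((coneSpan_le_iff_eq (by omega)).1 ?_))
    refine Submodule.span_le.2 fun x hx => ?_
    rw [← hk]
    exact le_antisymm (hcon x hx) (hp x (h.le hx))
  have vanish : ∀ {τ : PointedCone ℚ (Fin d → ℚ)} {l : Dual ℚ (Fin d → ℚ)},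
      LinearMap.ker l = coneSpan τ → ∀ x ∈ τ, l x = 0 := by
    intro τ l hk x hx
    rw [← LinearMap.mem_ker, hk]
    exact mem_coneSpan_of_mem hx
  have pos2 : ∀ {τ τ' τ'' : PointedCone ℚ (Fin d → ℚ)} {l l' : Dual ℚ (Fin d → ℚ)},
      τ.IsFaceOf σ → τ'.IsFaceOf σ → τ''.IsFaceOf σ → coneDim τ + 1 = d → coneDim τ' + 1 = d →
      coneDim τ'' + 1 = d → τ ≠ τ' → τ ≠ τ'' → LinearMap.ker l = coneSpan τ' →
      LinearMap.ker l' = coneSpan τ'' → (∀ x ∈ σ, 0 ≤ l x) → (∀ x ∈ σ, 0 ≤ l' x) →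
      ∃ x ∈ τ, 0 < l x ∧ 0 < l' x := by
    intro τ τ' τ'' l l' h h' h'' dt dt' dt'' n n' k k' p p'
    obtain ⟨x, hx, hlx⟩ := pos h h' dt dt' n k p
    obtain ⟨y, hy, hly⟩ := pos h h'' dt dt'' n' k' p'
    refine ⟨x + y, add_mem hx hy, ?_, ?_⟩ <;> rw [map_add]
    · linarith [p y (h.le hy)]
    · linarith [p' x (h.le hx)]
  -- On each facet, choose a point at which the supporting forms of the other two facets are both
  -- positive.
  obtain ⟨x₁, m₁, a₁₂, a₁₃⟩ := pos2 h₁ h₂ h₃ d₁ d₂ d₃ h₁₂ h₁₃ k₂ k₃ p₂ p₃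
  obtain ⟨x₂, m₂, a₂₁, a₂₃⟩ := pos2 h₂ h₁ h₃ d₂ d₁ d₃ h₁₂.symm h₂₃ k₁ k₃ p₁ p₃
  obtain ⟨x₃, m₃, a₃₁, a₃₂⟩ := pos2 h₃ h₁ h₂ d₃ d₁ d₂ h₁₃.symm h₂₃.symm k₁ k₂ p₁ p₂
  have z₁ := vanish k₁ x₁ m₁
  have z₂ := vanish k₂ x₂ m₂
  have z₃ := vanish k₃ x₃ m₃
  -- The three forms lie in the annihilator of ξ, which has dimension two.
  have hdep : ¬ LinearIndependent ℚ ![l₁, l₂, l₃] := by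
    intro hli
    have hmem : ∀ i, ![l₁, l₂, l₃] i ∈ ξ.dualAnnihilator := by
      intro i
      rw [Submodule.mem_dualAnnihilator]
      intro w hw
      fin_cases i
      · exact LinearMap.mem_ker.1 (k₁ ▸ le₁ hw)
      · exact LinearMap.mem_ker.1 (k₂ ▸ le₂ hw)
      · exact LinearMap.mem_ker.1 (k₃ ▸ le₃ hw)
    have hli' : LinearIndependent ℚ
        (fun i => (⟨![l₁, l₂, l₃] i, hmem i⟩ : ξ.dualAnnihilator)) :=
      LinearIndependent.of_comp ξ.dualAnnihilator.subtype hli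
    have hc := hli'.fintype_card_le_finrank
    have hf := Subspace.finrank_add_finrank_dualAnnihilator_eq ξ
    rw [finrank_fin_fun] at hf
    simp at hc
    omega
  rw [Fintype.linearIndependent_iff] at hdep
  push Not at hdep
  obtain ⟨c, hc, i, hi⟩ := hdep
  have ev : ∀ x, c 0 * l₁ x + c 1 * l₂ x + c 2 * l₃ x = 0 := by
    intro x
    have := congrArg (fun l : Dual ℚ (Fin d → ℚ) => l x) hc
    simpa [Fin.sum_univ_three] using this
  have e₁ := ev x₁
  have e₂ := ev x₂
  have e₃ := ev x₃
  rw [z₁] at e₁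
  rw [z₂] at e₂
  rw [z₃] at e₃
  -- At each chosen point one term of the relation drops out, so the other two coefficients have
  -- opposite signs or are both zero. Three numbers cannot have pairwise opposite signs, so all
  -- vanish.
  have key : ∀ {a b p q : ℚ}, 0 < p → 0 < q → a * p + b * q = 0 → (0 < a → b < 0) ∧
      (a < 0 → 0 < b) ∧ (a = 0 → b = 0) := by
    intro a b p q hp hq h
    refine ⟨fun ha => ?_, fun ha => ?_, fun ha => ?_⟩
    · have := mul_pos ha hp
      by_contra! hb
      have := mul_nonneg hb hq.le
      linarith
    · have := mul_neg_of_neg_of_pos ha hp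
      by_contra! hb
      have := mul_nonpos_of_nonpos_of_nonneg hb hq.le
      linarith
    · subst ha
      have : b * q = 0 := by linarith
      exact (mul_eq_zero.1 this).resolve_right hq.ne'
  obtain ⟨r1, r2, r3⟩ := key a₁₂ a₁₃ (by linarith : c 1 * l₂ x₁ + c 2 * l₃ x₁ = 0)
  obtain ⟨s1, s2, s3⟩ := key a₂₃ a₂₁ (by linarith : c 2 * l₃ x₂ + c 0 * l₁ x₂ = 0)
  obtain ⟨t1, t2, t3⟩ := key a₃₁ a₃₂ (by linarith : c 0 * l₁ x₃ + c 1 * l₂ x₃ = 0)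
  rcases lt_trichotomy (c 1) 0 with h | h | h
  · linarith [t2 (s1 (r2 h))]
  · refine hi ?_
    match i with
    | 0 => exact s3 (r3 h)
    | 1 => exact h
    | 2 => exact r3 h
  · linarith [t1 (s2 (r1 h))]

theorem finrank_sup_of_ne {H H' : Submodule ℚ (Fin d → ℚ)} (h : finrank ℚ H + 1 = d)
    (h' : finrank ℚ H' + 1 = d) (hne : H ≠ H') : H ⊔ H' = ⊤ := by
  refine Submodule.eq_top_of_finrank_eq ?_
  have h1 : H < H ⊔ H' := by
    refine lt_of_le_of_ne le_sup_left fun e => hne ?_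
    have : H' ≤ H := by rw [e]; exact le_sup_right
    exact (Submodule.eq_of_le_of_finrank_eq this (by omega)).symm
  have h2 := Submodule.finrank_lt_finrank_of_lt h1
  have h3 := Submodule.finrank_le (H ⊔ H')
  rw [finrank_fin_fun] at h3 ⊢
  omega

theorem finrank_inf_of_ne {H H' : Submodule ℚ (Fin d → ℚ)} (h : finrank ℚ H + 1 = d)
    (h' : finrank ℚ H' + 1 = d) (hne : H ≠ H') :
    finrank ℚ (H ⊓ H' : Submodule ℚ (Fin d → ℚ)) + 2 = d := by
  have h1 := Submodule.finrank_sup_add_finrank_inf_eq H H'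
  rw [finrank_sup_of_ne h h' hne, finrank_top, finrank_fin_fun] at h1
  omega

end Cones

/-! ### How full-dimensional cones of a fan meet along facets. -/

namespace PolyhedralFan

variable {d : ℕ} (F : PolyhedralFan d)

/-- A span strictly larger than a hyperplane is the whole space, and a common face with full span
equals both cones. -/
theorem eq_of_coneSpan_lt {α α' τ : PointedCone ℚ (Fin d → ℚ)} (hα : α ∈ F.faces d)
    (hα' : α' ∈ F.faces d) (hd : coneDim τ + 1 = d) (h : coneSpan τ < coneSpan (α ⊓ α')) :
    α = α' := by
  have h1 := Submodule.finrank_lt_finrank_of_lt h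
  have h2 := Submodule.finrank_le (coneSpan (α ⊓ α'))
  rw [finrank_fin_fun] at h2
  have htop : coneSpan (α ⊓ α') = ⊤ := by
    refine Submodule.eq_top_of_finrank_eq ?_
    rw [finrank_fin_fun]
    change finrank ℚ (coneSpan τ) + 1 = d at hd
    omega
  obtain ⟨f, f'⟩ := F.inter_isFaceOf α hα.1 α' hα'.1
  exact (f.eq_of_coneSpan_eq_top htop).symm.trans (f'.eq_of_coneSpan_eq_top htop)

theorem eq_of_two_facets {α α' τ τ' : PointedCone ℚ (Fin d → ℚ)} (hα : α ∈ F.faces d)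
    (hα' : α' ∈ F.faces d) (hd : coneDim τ + 1 = d) (hd' : coneDim τ' + 1 = d)
    (h1 : τ.IsFaceOf α) (h2 : τ.IsFaceOf α') (h3 : τ'.IsFaceOf α) (h4 : τ'.IsFaceOf α')
    (hne : τ ≠ τ') : α = α' := by
  refine F.eq_of_coneSpan_lt hα hα' hd ?_
  refine lt_of_le_of_ne (coneSpan_mono (le_inf h1.le h2.le)) fun e => ?_
  have : coneSpan τ' ≤ coneSpan τ := by
    rw [e]; exact coneSpan_mono (le_inf h3.le h4.le)
  exact hne (h1.eq_of_coneSpan_eq h3 ((coneSpan_le_iff_eq (by omega)).1 this).symm)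

/-- Take points of the two cones off the hyperplane and rescale one so that their `l`-values agree.
Their difference is in span τ, so adding suitable elements of τ to each makes them equal: the cones
share a point off the hyperplane. -/
theorem eq_of_same_side {α α' τ : PointedCone ℚ (Fin d → ℚ)} (hα : α ∈ F.faces d)
    (hα' : α' ∈ F.faces d) (hd : coneDim τ + 1 = d) (h : τ.IsFaceOf α) (h' : τ.IsFaceOf α')
    {l : Dual ℚ (Fin d → ℚ)} (hl : LinearMap.ker l = coneSpan τ) (hp : ∀ x ∈ α, 0 ≤ l x)
    (hp' : ∀ x ∈ α', 0 ≤ l x) : α = α' := by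
  have pos : ∀ {α : PointedCone ℚ (Fin d → ℚ)}, α ∈ F.faces d → (∀ x ∈ α, 0 ≤ l x) →
      ∃ x ∈ α, 0 < l x := by
    intro α hα hp
    by_contra! hcon
    have : coneSpan α ≤ coneSpan τ := by
      refine Submodule.span_le.2 fun x hx => ?_
      rw [← hl]
      exact le_antisymm (hcon x hx) (hp x hx)
    have := Submodule.finrank_mono this
    have h2 := hα.2
    unfold coneDim at h2 hd
    omega
  obtain ⟨s, hs, ls⟩ := pos hα hp
  obtain ⟨s', hs', ls'⟩ := pos hα' hp'
  have hz : s' - (l s' / l s) • s ∈ coneSpan τ := by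
    rw [← hl, LinearMap.mem_ker]
    simp only [map_sub, map_smul, smul_eq_mul]
    field_simp
    ring
  obtain ⟨a, ha, b, hb, e⟩ := mem_coneSpan_iff.1 hz
  have e' : s' + b = (l s' / l s) • s + a := by
    rw [sub_eq_sub_iff_add_eq_add] at e
    rw [e, add_comm]
  have hw : s' + b ∈ α ⊓ α' := by
    refine ⟨?_, add_mem hs' (h'.le hb)⟩
    have : (l s' / l s) • s + a ∈ α :=
      add_mem (α.smul_mem (div_nonneg ls'.le ls.le) hs) (h.le ha)
    rw [← e'] at this
    exact this
  refine F.eq_of_coneSpan_lt hα hα' hd ?_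
  refine lt_of_le_of_ne (coneSpan_mono (le_inf h.le h'.le)) fun e => ?_
  have hm := mem_coneSpan_of_mem hw
  rw [← e, ← hl, LinearMap.mem_ker, map_add] at hm
  have : l b = 0 := by
    rw [← LinearMap.mem_ker, hl]; exact mem_coneSpan_of_mem hb
  linarith

theorem not_three_of_facet {α₁ α₂ α₃ τ : PointedCone ℚ (Fin d → ℚ)} (h₁ : α₁ ∈ F.faces d)
    (h₂ : α₂ ∈ F.faces d) (h₃ : α₃ ∈ F.faces d) (hd : coneDim τ + 1 = d) (f₁ : τ.IsFaceOf α₁)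
    (f₂ : τ.IsFaceOf α₂) (f₃ : τ.IsFaceOf α₃) : α₁ = α₂ ∨ α₁ = α₃ ∨ α₂ = α₃ := by
  obtain ⟨l, hl⟩ := exists_ker_eq hd
  have hl' : LinearMap.ker (-l) = coneSpan τ := by
    rw [← hl]; ext x; simp
  rcases ker_sign_of_isFaceOf f₁ hl with s₁ | s₁ <;> rcases ker_sign_of_isFaceOf f₂ hl with s₂ | s₂
    <;> rcases ker_sign_of_isFaceOf f₃ hl with s₃ | s₃
  all_goals first
    | exact Or.inl (F.eq_of_same_side h₁ h₂ hd f₁ f₂ hl s₁ s₂)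
    | exact Or.inl (F.eq_of_same_side h₁ h₂ hd f₁ f₂ hl' s₁ s₂)
    | exact Or.inr (Or.inl (F.eq_of_same_side h₁ h₃ hd f₁ f₃ hl s₁ s₃))
    | exact Or.inr (Or.inl (F.eq_of_same_side h₁ h₃ hd f₁ f₃ hl' s₁ s₃))
    | exact Or.inr (Or.inr (F.eq_of_same_side h₂ h₃ hd f₂ f₃ hl s₂ s₃))
    | exact Or.inr (Or.inr (F.eq_of_same_side h₂ h₃ hd f₂ f₃ hl' s₂ s₃))

/-- In a hereditary fan an interior cone of codimension one is a face of exactly two cones of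
full dimension. -/
theorem exists_two_cones (hF : F.IsHereditary) {τ : PointedCone ℚ (Fin d → ℚ)}
    (hτ : τ ∈ F.cones) (hd : coneDim τ + 1 = d) (hb : ¬ F.IsBoundary τ) :
    ∃ α ∈ F.faces d, ∃ α' ∈ F.faces d, α ≠ α' ∧ τ.IsFaceOf α ∧ τ.IsFaceOf α' ∧
      ∀ γ ∈ F.faces d, τ.IsFaceOf γ → γ = α ∨ γ = α' := by
  obtain ⟨⟨α, hα, hτα⟩⟩ := (hF τ hτ).nonempty
  have : ∃ α' ∈ F.faces d, τ.IsFaceOf α' ∧ α' ≠ α := by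
    by_contra! hcon
    exact hb ⟨τ, hτ, hd, ⟨α, ⟨hα, hτα⟩, fun y hy => hcon y hy.1 hy.2⟩, .rfl⟩
  obtain ⟨α', hα', hτα', hne⟩ := this
  refine ⟨α, hα, α', hα', hne.symm, hτα, hτα', fun γ hγ hτγ => ?_⟩
  rcases F.not_three_of_facet hα hα' hγ hd hτα hτα' hτγ with h | h | h
  · exact absurd h.symm hne
  · exact Or.inl h.symm
  · exact Or.inr h.symm

end PolyhedralFan

/-! ### Incidence signs -/

section Incidence

variable {W S : Type*}

open scoped Classical in
/-- The incidence number of `w` with `s`, when `w` is oriented from `m w` to `p w`. -/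
def incidenceSign (R : Type*) [Ring R] (p m : W → S) (w : W) (s : S) : R :=
  (if p w = s then 1 else 0) - (if m w = s then 1 else 0)

/-- The functions on `W` whose signed sum vanishes at every `s`. -/
def incidenceKernel (R : Type*) [CommRing R] [Fintype W] (p m : W → S) : Submodule R (W → R) where
  carrier := {φ | ∀ s, ∑ w, incidenceSign R p m w s * φ w = 0}
  add_mem' := by
    intro a b ha hb s
    simp [mul_add, Finset.sum_add_distrib, ha s, hb s]
  zero_mem' := by simp
  smul_mem' := by
    intro r a ha s
    simp only [Pi.smul_apply, smul_eq_mul, mul_left_comm _ r, ← Finset.mul_sum, ha s, mul_zero]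

theorem incidenceSign_intCast (p m : W → S) (w : W) (s : S) :
    ((incidenceSign ℤ p m w s : ℤ) : ℚ) = incidenceSign ℚ p m w s := by
  simp only [incidenceSign]
  split_ifs <;> simp

theorem incidenceSign_of_left {R : Type*} [Ring R] {p m : W → S} (h : ∀ w, p w ≠ m w) (w : W) :
    incidenceSign R p m w (p w) = 1 := by
  simp [incidenceSign, (h w).symm]

theorem incidenceSign_of_right {R : Type*} [Ring R] {p m : W → S} (h : ∀ w, p w ≠ m w) (w : W) :
    incidenceSign R p m w (m w) = -1 := by
  simp [incidenceSign, h w]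

theorem incidenceSign_eq_zero {R : Type*} [Ring R] {p m : W → S} {w : W} {s : S}
    (h : ¬ (p w = s ∨ m w = s)) : incidenceSign R p m w s = 0 := by
  rw [not_or] at h
  simp [incidenceSign, h.1, h.2]

/-- Clearing denominators: integral and rational incidence kernels have the same rank. -/
theorem finrank_incidenceKernel_int [Fintype W] (p m : W → S) :
    finrank ℤ (incidenceKernel ℤ p m) = finrank ℚ (incidenceKernel ℚ p m) := by
  classical
  have hmem : ∀ φ ∈ incidenceKernel ℤ p m, (fun w => (φ w : ℚ)) ∈ incidenceKernel ℚ p m := by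
    intro φ hφ s
    simp only [← incidenceSign_intCast]
    exact_mod_cast hφ s
  let f : incidenceKernel ℤ p m →ₗ[ℤ] incidenceKernel ℚ p m :=
    { toFun := fun φ => ⟨fun w => (φ.1 w : ℚ), hmem _ φ.2⟩
      map_add' := fun a b => by ext w; simp
      map_smul' := fun a b => by ext w; simp }
  have hloc : IsLocalizedModule (nonZeroDivisors ℤ) f :=
    { map_units := by
        intro n
        have hn : ((n : ℤ) : ℚ) ≠ 0 := by exact_mod_cast nonZeroDivisors.coe_ne_zero n
        rw [Module.End.isUnit_iff]
        constructor
        · intro a b hab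
          ext w
          have := congrFun (congrArg Subtype.val hab) w
          simpa [hn] using this
        · intro b
          refine ⟨((n : ℤ) : ℚ)⁻¹ • b, ?_⟩
          ext w
          simp [hn]
      surj := by
        intro y
        obtain ⟨n, hn⟩ := IsLocalization.exist_integer_multiples_of_finite (nonZeroDivisors ℤ) y.1
        choose x hx using hn
        have hx' : ∀ w, (x w : ℚ) = ((n : ℤ) : ℚ) * y.1 w := by
          intro w
          simpa using hx w
        refine ⟨(⟨x, fun s => ?_⟩, n), ?_⟩
        · have h1 : ∑ w, incidenceSign ℚ p m w s * y.1 w = 0 := y.2 s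
          have h2 : ((∑ w, incidenceSign ℤ p m w s * x w : ℤ) : ℚ) = 0 := by
            push_cast
            simp only [incidenceSign_intCast, hx', mul_left_comm _ ((n : ℤ) : ℚ),
              ← Finset.mul_sum, h1, mul_zero]
          exact_mod_cast h2
        · ext w
          simp [f, hx', Submonoid.smul_def]
      exists_of_eq := by
        intro a b hab
        refine ⟨1, ?_⟩
        congr 1
        ext w
        have := congrFun (congrArg Subtype.val hab) w
        simpa [f] using this }
  rw [← IsLocalizedModule.finrank_eq (nonZeroDivisors ℤ) f le_rfl]
  exact (IsLocalization.finrank_eq ℚ (nonZeroDivisors ℤ) le_rfl).symm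

variable [Fintype W] {p m : W → S}

/-- Suppose that any two distinct `w`, `w'` have at most one common endpoint and that no `s` is an
endpoint of three distinct `w`. Then the first homology of the graph in which `w` and `w'` are
joined when they have a common endpoint is the incidence kernel: in terms of the graph with
vertex set `S`, this compares the cycles of a graph with those of its line graph. -/
theorem graphBettiOne_eq_finrank_incidenceKernel (G : SimpleGraph W) (hne : ∀ w, p w ≠ m w)
    (hG : ∀ w w', G.Adj w w' ↔ w ≠ w' ∧ ∃ s, (p w = s ∨ m w = s) ∧ (p w' = s ∨ m w' = s))
    (huniq : ∀ w w' s s', w ≠ w' → (p w = s ∨ m w = s) → (p w' = s ∨ m w' = s) →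
      (p w = s' ∨ m w = s') → (p w' = s' ∨ m w' = s') → s = s')
    (hthree : ∀ s w₁ w₂ w₃, w₁ ≠ w₂ → w₁ ≠ w₃ → w₂ ≠ w₃ → (p w₁ = s ∨ m w₁ = s) →
      (p w₂ = s ∨ m w₂ = s) → (p w₃ = s ∨ m w₃ = s) → False) :
    graphBettiOne G = finrank ℚ (incidenceKernel ℚ p m) := by
  classical
  rw [← finrank_incidenceKernel_int]
  have self_zero : ∀ c ∈ graphOneChains G, ∀ w, c w w = 0 := fun c hc w => hc.2 w w (by simp)
  -- Reading `c w' w` as flow from `w'` to `w`, `Φ c w` is the flow entering `w` through its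
  -- endpoint `p w`. For a cycle, the flow entering through `m w` is its negative.
  let Φ : (W → W → ℤ) →ₗ[ℤ] (W → ℤ) :=
    { toFun := fun c w => ∑ w', if p w' = p w ∨ m w' = p w then c w' w else 0
      map_add' := fun a b => by
        ext w
        simp only [Pi.add_apply, ← Finset.sum_add_distrib]
        exact Finset.sum_congr rfl fun _ _ => by split_ifs <;> simp
      map_smul' := fun r a => by
        ext w
        simp [Finset.mul_sum] }
  have Φ_apply : ∀ c w, Φ c w = ∑ w', if p w' = p w ∨ m w' = p w then c w' w else 0 :=
    fun _ _ => rfl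
  have sign_Φ : ∀ c ∈ graphOneChains G, (∀ w, ∑ v, c v w = 0) → ∀ w s, (p w = s ∨ m w = s) →
      incidenceSign ℤ p m w s * Φ c w = ∑ w', if p w' = s ∨ m w' = s then c w' w else 0 := by
    rintro c hc hb w s (rfl | rfl)
    · rw [incidenceSign_of_left hne, one_mul, Φ_apply]
    · rw [incidenceSign_of_right hne, Φ_apply, neg_one_mul, neg_eq_iff_add_eq_zero,
        ← Finset.sum_add_distrib]
      refine Eq.trans (Finset.sum_congr rfl fun w' _ => ?_) (hb w)
      by_cases hadj : G.Adj w' w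
      · obtain ⟨hn, s, h1, h2⟩ := (hG _ _).1 hadj
        have not_both : ¬ ((p w' = p w ∨ m w' = p w) ∧ (p w' = m w ∨ m w' = m w)) := fun h =>
          hne w (huniq w' w _ _ hn h.1 (Or.inl rfl) h.2 (Or.inr rfl))
        rcases h2 with rfl | rfl
        · rw [if_pos h1, if_neg fun h => not_both ⟨h1, h⟩, add_zero]
        · rw [if_pos h1, if_neg fun h => not_both ⟨h, h1⟩, zero_add]
      · simp [hc.2 _ _ hadj]
  have hΦmem : ∀ c : LinearMap.ker (graphBoundary G), Φ c.1.1 ∈ incidenceKernel ℤ p m := by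
    rintro ⟨⟨c, hc⟩, hker⟩ s
    have hb : ∀ w, ∑ v, c v w = 0 := fun w => congrFun (LinearMap.mem_ker.1 hker) w
    have h1 : ∀ w, incidenceSign ℤ p m w s * Φ c w =
        ∑ w', if (p w = s ∨ m w = s) ∧ (p w' = s ∨ m w' = s) then c w' w else 0 := by
      intro w
      by_cases h : p w = s ∨ m w = s
      · rw [sign_Φ c hc hb w s h]
        simp only [h, true_and]
      · rw [incidenceSign_eq_zero h]
        simp only [h, false_and, if_false, zero_mul, Finset.sum_const_zero]
    change ∑ w, incidenceSign ℤ p m w s * Φ c w = 0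
    simp only [h1]
    -- The total inflow over all `w` at `s` is a symmetric double sum of an antisymmetric function,
    -- hence equals its own negative.
    have h2 : (∑ w, ∑ w', if (p w = s ∨ m w = s) ∧ (p w' = s ∨ m w' = s) then c w' w else 0) =
        -∑ w, ∑ w', if (p w = s ∨ m w = s) ∧ (p w' = s ∨ m w' = s) then c w' w else 0 := by
      conv_lhs => rw [Finset.sum_comm]
      simp only [← Finset.sum_neg_distrib]
      refine Finset.sum_congr rfl fun w _ => Finset.sum_congr rfl fun w' _ => ?_
      rw [hc.1 w' w]
      by_cases h3 : p w = s ∨ m w = s <;> by_cases h4 : p w' = s ∨ m w' = s <;> simp [h3, h4]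
    omega
  let Ψ : LinearMap.ker (graphBoundary G) →ₗ[ℤ] incidenceKernel ℤ p m :=
    (Φ ∘ₗ (graphOneChains G).subtype ∘ₗ (LinearMap.ker (graphBoundary G)).subtype).codRestrict _
      hΦmem
  have hΨ : ∀ c, (Ψ c).1 = Φ c.1.1 := fun _ => rfl
  refine (LinearEquiv.ofBijective Ψ ⟨?_, ?_⟩).finrank_eq
  · rw [← LinearMap.ker_eq_bot, LinearMap.ker_eq_bot']
    rintro ⟨⟨c, hc⟩, hker⟩ h0
    have hb : ∀ w, ∑ v, c v w = 0 := fun w => congrFun (LinearMap.mem_ker.1 hker) w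
    have hΦ0 : ∀ w, Φ c w = 0 := fun w => congrFun (congrArg Subtype.val h0) w
    ext w' w
    change c w' w = 0
    by_cases hadj : G.Adj w' w
    · obtain ⟨hn, s, h1, h2⟩ := (hG _ _).1 hadj
      have h3 := sign_Φ c hc hb w s h2
      rw [hΦ0, mul_zero, Finset.sum_eq_single w'] at h3
      · rwa [if_pos h1, eq_comm] at h3
      -- As `s` has no third incident element, `c w' w` is the only possibly nonzero contribution to
      -- the inflow of `w` through `s`, and that inflow is zero.
      · intro v _ hv
        by_cases hvw : v = w
        · subst hvw
          simp [self_zero c hc]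
        · exact if_neg fun h4 => hthree s v w' w hv hvw hn h4 h1 h2
      · simp
    · exact hc.2 _ _ hadj
  · rintro ⟨φ, hφ⟩
    have pair : ∀ w w' s, w ≠ w' → (p w = s ∨ m w = s) → (p w' = s ∨ m w' = s) →
        incidenceSign ℤ p m w s * φ w + incidenceSign ℤ p m w' s * φ w' = 0 := by
      intro w w' s hn h1 h2
      rw [← hφ s, ← Finset.sum_subset (Finset.subset_univ {w, w'}), Finset.sum_pair hn]
      intro v _ hv
      simp only [Finset.mem_insert, Finset.mem_singleton, not_or] at hv
      rw [incidenceSign_eq_zero fun h3 => hthree s v w w' hv.1 hv.2 hn h3 h1 h2, zero_mul]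
    -- If `w` has a neighbour through `s`, it is unique and carries all the flow; if it has none,
    -- the kernel condition at `s` forces `φ w = 0`.
    have count : ∀ w s, (p w = s ∨ m w = s) →
        (∑ w', if w ≠ w' ∧ (p w' = s ∨ m w' = s) then φ w else 0) = φ w := by
      intro w s h1
      by_cases hex : ∃ w', w ≠ w' ∧ (p w' = s ∨ m w' = s)
      · obtain ⟨w', hn, h2⟩ := hex
        rw [Finset.sum_eq_single w']
        · rw [if_pos ⟨hn, h2⟩]
        · intro v _ hv
          exact if_neg fun h3 => hthree s v w w' h3.1.symm hv hn h3.2 h1 h2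
        · simp
      · have h0 : φ w = 0 := by
          have h2 := hφ s
          rw [Finset.sum_eq_single w] at h2
          · rcases h1 with rfl | rfl
            · simpa [incidenceSign_of_left hne] using h2
            · simpa [incidenceSign_of_right hne] using h2
          · intro v _ hv
            rw [incidenceSign_eq_zero fun h3 => hex ⟨v, hv.symm, h3⟩, zero_mul]
          · simp
        simp [h0]
    -- The inverse construction: through each endpoint, `φ w` flows between `w` and its neighbour
    -- there, entering at `p w` and leaving at `m w`. The vertex balance is built in, and
    -- antisymmetry is the kernel condition.
    let c : W → W → ℤ := fun w' w =>
      (if w ≠ w' ∧ (p w' = p w ∨ m w' = p w) then φ w else 0) -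
        (if w ≠ w' ∧ (p w' = m w ∨ m w' = m w) then φ w else 0)
    have c_eq : ∀ w w' s, w ≠ w' → (p w = s ∨ m w = s) → (p w' = s ∨ m w' = s) →
        c w' w = incidenceSign ℤ p m w s * φ w := by
      intro w w' s hn h1 h2
      have not_both : ¬ ((p w' = p w ∨ m w' = p w) ∧ (p w' = m w ∨ m w' = m w)) := fun h =>
        hne w (huniq w' w _ _ hn.symm h.1 (Or.inl rfl) h.2 (Or.inr rfl))
      rcases h1 with rfl | rfl
      · have h3 : ¬ (p w' = m w ∨ m w' = m w) := fun h => not_both ⟨h2, h⟩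
        simp only [c, if_pos (And.intro hn h2), h3, and_false, if_false,
          incidenceSign_of_left hne, sub_zero, one_mul]
      · have h3 : ¬ (p w' = p w ∨ m w' = p w) := fun h => not_both ⟨h, h2⟩
        simp only [c, if_pos (And.intro hn h2), h3, and_false, if_false,
          incidenceSign_of_right hne, zero_sub, neg_one_mul]
    have c_zero : ∀ w w', ¬ G.Adj w' w → c w' w = 0 := by
      intro w w' hadj
      have h1 : ¬ (w ≠ w' ∧ (p w' = p w ∨ m w' = p w)) := fun h =>
        hadj ((hG _ _).2 ⟨h.1.symm, _, h.2, Or.inl rfl⟩)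
      have h2 : ¬ (w ≠ w' ∧ (p w' = m w ∨ m w' = m w)) := fun h =>
        hadj ((hG _ _).2 ⟨h.1.symm, _, h.2, Or.inr rfl⟩)
      simp only [c, if_neg h1, if_neg h2, sub_zero]
    have hc : c ∈ graphOneChains G := by
      refine ⟨fun w w' => ?_, fun w w' h => c_zero w' w h⟩
      by_cases hadj : G.Adj w w'
      · obtain ⟨hn, s, h1, h2⟩ := (hG _ _).1 hadj
        rw [c_eq w w' s hn h1 h2, c_eq w' w s hn.symm h2 h1, eq_neg_iff_add_eq_zero]
        exact pair w w' s hn h1 h2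
      · rw [c_zero _ _ hadj, c_zero _ _ fun h => hadj h.symm, neg_zero]
    have hb : (⟨c, hc⟩ : graphOneChains G) ∈ LinearMap.ker (graphBoundary G) := by
      rw [LinearMap.mem_ker]
      funext w
      change ∑ v, c v w = 0
      simp only [c, Finset.sum_sub_distrib]
      rw [count w _ (Or.inl rfl), count w _ (Or.inr rfl), sub_self]
    refine ⟨⟨⟨c, hc⟩, hb⟩, ?_⟩
    ext w
    rw [hΨ]
    change Φ c w = φ w
    rw [Φ_apply, ← count w (p w) (Or.inl rfl)]
    refine Finset.sum_congr rfl fun w' _ => ?_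
    by_cases hn : w = w'
    · subst hn
      simp [self_zero c hc]
    · by_cases h1 : p w' = p w ∨ m w' = p w
      · rw [if_pos h1, if_pos ⟨hn, h1⟩, c_eq w w' (p w) hn (Or.inl rfl) h1,
          incidenceSign_of_left hne, one_mul]
      · rw [if_neg h1, if_neg fun h => h1 h.2]

end Incidence

/-! ### The dimension count and the annihilator of the coboundaries. -/

section LinearAlgebra

/-- The preimage of `N` is the kernel of (x, n) ↦ D x − n on `X × N`, whose range is range D + N;
apply rank-nullity. The codimension of that range is the dimension of its annihilator. -/
theorem finrank_comap_add {X Y : Type*} [AddCommGroup X] [AddCommGroup Y] [Module ℚ X] [Module ℚ Y]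
    [FiniteDimensional ℚ X] [FiniteDimensional ℚ Y] (D : X →ₗ[ℚ] Y) (N : Submodule ℚ Y) :
    finrank ℚ (N.comap D) + finrank ℚ Y =
      finrank ℚ X + finrank ℚ N + finrank ℚ (LinearMap.range D ⊔ N).dualAnnihilator := by
  let E : X × N →ₗ[ℚ] Y := D.coprod (-N.subtype)
  have hE : ∀ z, E z = D z.1 - z.2 := fun z => by simp [E, sub_eq_add_neg]
  have hrange : LinearMap.range E = LinearMap.range D ⊔ N := by
    rw [LinearMap.range_coprod, LinearMap.range_neg, Submodule.range_subtype]
  let e : N.comap D ≃ₗ[ℚ] LinearMap.ker E :=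
    { toFun := fun x => ⟨(x.1, ⟨D x.1, x.2⟩), by simp [hE]⟩
      map_add' := fun x y => by ext <;> simp
      map_smul' := fun c x => by ext <;> simp
      invFun := fun z => ⟨z.1.1, by
        have h : D z.1.1 = z.1.2 := sub_eq_zero.1 ((hE z.1).symm.trans z.2)
        rw [Submodule.mem_comap, h]
        exact z.1.2.2⟩
      left_inv := fun x => rfl
      right_inv := fun z => by
        have h : D z.1.1 = z.1.2 := sub_eq_zero.1 ((hE z.1).symm.trans z.2)
        ext
        · rfl
        · exact h }
  have h1 := E.finrank_range_add_finrank_ker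
  have h2 := Subspace.finrank_add_finrank_dualAnnihilator_eq (LinearMap.range D ⊔ N)
  rw [hrange, ← e.finrank_eq, finrank_prod] at h1
  omega

variable {B S V : Type*} [AddCommGroup V] [Module ℚ V]

/-- The coboundary map `f ↦ (f (p b) - f (m b))_b`. -/
def differenceMap (V : Type*) [AddCommGroup V] [Module ℚ V] (p m : B → S) :
    (S → V) →ₗ[ℚ] (B → V) :=
  LinearMap.pi fun b => LinearMap.proj (R := ℚ) (φ := fun _ : S => V) (p b) -
    LinearMap.proj (R := ℚ) (φ := fun _ : S => V) (m b)

@[simp]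
theorem differenceMap_apply (p m : B → S) (f : S → V) (b : B) :
    differenceMap V p m f b = f (p b) - f (m b) := rfl

variable [Fintype B]

theorem finrank_submodule_pi (A : B → Submodule ℚ V) [FiniteDimensional ℚ V] :
    finrank ℚ (Submodule.pi Set.univ A) = ∑ b, finrank ℚ (A b) := by
  let e : Submodule.pi Set.univ A ≃ₗ[ℚ] (∀ b, A b) :=
    { toFun := fun f b => ⟨f.1 b, f.2 b trivial⟩
      map_add' := fun _ _ => rfl
      map_smul' := fun _ _ => rfl
      invFun := fun f => ⟨fun b => (f b).1, fun b _ => (f b).2⟩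
      left_inv := fun _ => rfl
      right_inv := fun _ => rfl }
  rw [e.finrank_eq, finrank_pi_fintype]

variable [Fintype S]

theorem sum_incidenceSign_mul {W : Type*} (p m : W → S) (w : W) (x : S → ℚ) :
    ∑ s, incidenceSign ℚ p m w s * x s = x (p w) - x (m w) := by
  classical
  simp [incidenceSign, sub_mul, Finset.sum_sub_distrib]

/-- By `hspan`, an annihilating functional is a combination of the `ev ξ` in each coordinate, with
coefficients unique by independence. Summation by parts turns vanishing on coboundaries into the
incidence condition for each ξ separately; vanishing on the `A b` is automatic by `hA`. -/
theorem finrank_dualAnnihilator_eq_sum_incidenceKernel [DecidableEq B] (p m : B → S)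
    (A : B → Submodule ℚ V) {Ξ : Type*} [Fintype Ξ] (ev : Ξ → Dual ℚ V)
    (hev : LinearIndependent ℚ ev) (W : Ξ → Type*) [∀ ξ, Fintype (W ξ)] (ι : ∀ ξ, W ξ → B)
    (hι : ∀ ξ, Function.Injective (ι ξ)) (hA : ∀ ξ w, ∀ a ∈ A (ι ξ w), ev ξ a = 0)
    (hspan : ∀ θ ∈ (LinearMap.range (differenceMap V p m) ⊔
        Submodule.pi Set.univ A).dualAnnihilator, ∀ b,
      θ ∘ₗ LinearMap.single ℚ (fun _ => V) b ∈ Submodule.span ℚ (ev '' {ξ | ∃ w, ι ξ w = b})) :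
    finrank ℚ (LinearMap.range (differenceMap V p m) ⊔ Submodule.pi Set.univ A).dualAnnihilator =
      ∑ ξ, finrank ℚ (incidenceKernel ℚ (p ∘ ι ξ) (m ∘ ι ξ)) := by
  classical
  let T : (∀ ξ, W ξ → ℚ) →ₗ[ℚ] Dual ℚ (B → V) :=
    { toFun := fun c => ∑ ξ, ∑ w, c ξ w • (ev ξ ∘ₗ LinearMap.proj (ι ξ w))
      map_add' := fun a b => by simp [add_smul, Finset.sum_add_distrib]
      map_smul' := fun r a => by simp [mul_smul, Finset.smul_sum] }
  have T_apply : ∀ c f, T c f = ∑ ξ, ∑ w, c ξ w * ev ξ (f (ι ξ w)) := fun c f => by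
    simp [T]
  have indep : ∀ a : Ξ → ℚ, (∀ v, ∑ ξ, a ξ * ev ξ v = 0) → ∀ ξ, a ξ = 0 := by
    intro a ha
    refine Fintype.linearIndependent_iff.1 hev a ?_
    ext v
    simpa using ha v
  have T_diff : ∀ c g, T c (differenceMap V p m g) = ∑ s, ∑ ξ,
      (∑ w, incidenceSign ℚ (p ∘ ι ξ) (m ∘ ι ξ) w s * c ξ w) * ev ξ (g s) := by
    intro c g
    rw [T_apply, Finset.sum_comm]
    refine Finset.sum_congr rfl fun ξ _ => ?_
    simp only [Finset.sum_mul]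
    rw [Finset.sum_comm]
    refine Finset.sum_congr rfl fun w _ => ?_
    have h := sum_incidenceSign_mul (p ∘ ι ξ) (m ∘ ι ξ) w (fun s => ev ξ (g s))
    rw [differenceMap_apply, map_sub]
    simp only [Function.comp_apply] at h
    rw [← h, Finset.mul_sum]
    exact Finset.sum_congr rfl fun s _ => by ring
  have T_mem_iff : ∀ c, T c ∈ (LinearMap.range (differenceMap V p m) ⊔
      Submodule.pi Set.univ A).dualAnnihilator ↔
        ∀ ξ, c ξ ∈ incidenceKernel ℚ (p ∘ ι ξ) (m ∘ ι ξ) := by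
    intro c
    rw [Submodule.dualAnnihilator_sup_eq, Submodule.mem_inf, Submodule.mem_dualAnnihilator,
      Submodule.mem_dualAnnihilator]
    constructor
    -- Testing on functions supported at `s` gives a linear relation among the `ev ξ`, whose
    -- coefficients must vanish.
    · rintro ⟨h, -⟩ ξ s
      refine indep (fun ξ => ∑ w, incidenceSign ℚ (p ∘ ι ξ) (m ∘ ι ξ) w s * c ξ w) (fun v => ?_) ξ
      have h1 := h _ ⟨Pi.single s v, rfl⟩
      rw [T_diff, Finset.sum_eq_single s] at h1
      · simpa using h1
      · intro t _ ht
        simp [Pi.single_eq_of_ne ht]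
      · simp
    · intro h
      refine ⟨?_, fun f hf => ?_⟩
      · rintro _ ⟨g, rfl⟩
        rw [T_diff]
        refine Finset.sum_eq_zero fun s _ => Finset.sum_eq_zero fun ξ _ => ?_
        rw [h ξ s, zero_mul]
      · rw [T_apply]
        refine Finset.sum_eq_zero fun ξ _ => Finset.sum_eq_zero fun w _ => ?_
        rw [hA ξ w _ (hf _ trivial), mul_zero]
  have T_inj : Function.Injective T := by
    rw [← LinearMap.ker_eq_bot, LinearMap.ker_eq_bot']
    intro c hc
    funext ξ w
    have h := indep (fun ξ' => ∑ w', if ι ξ' w' = ι ξ w then c ξ' w' else 0) (fun v => ?_) ξ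
    · simpa [(hι ξ).eq_iff] using h
    · have h1 : T c (Pi.single (ι ξ w) v) = 0 := by rw [hc]; rfl
      rw [T_apply] at h1
      refine Eq.trans (Finset.sum_congr rfl fun ξ' _ => ?_) h1
      rw [Finset.sum_mul]
      refine Finset.sum_congr rfl fun w' _ => ?_
      by_cases h2 : ι ξ' w' = ι ξ w
      · rw [if_pos h2, h2, Pi.single_eq_same]
      · rw [if_neg h2, Pi.single_eq_of_ne h2, map_zero, zero_mul, mul_zero]
  have T_surj : ∀ θ ∈ (LinearMap.range (differenceMap V p m) ⊔
      Submodule.pi Set.univ A).dualAnnihilator, ∃ c, T c = θ := by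
    intro θ hθ
    have h1 : ∀ b, ∃ a : Ξ → ℚ, (∀ ξ, (¬ ∃ w, ι ξ w = b) → a ξ = 0) ∧
        ∀ v, ∑ ξ, a ξ * ev ξ v = θ (Pi.single b v) := by
      intro b
      obtain ⟨a, ha, e⟩ := (Finsupp.mem_span_image_iff_linearCombination ℚ).1 (hspan θ hθ b)
      refine ⟨a, fun ξ hξ => ?_, fun v => ?_⟩
      · by_contra h
        exact hξ (ha (Finsupp.mem_support_iff.2 h))
      · have h2 := LinearMap.congr_fun e v
        rw [Finsupp.linearCombination_apply, Finsupp.sum_fintype _ _ (by simp)] at h2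
        simpa using h2
    choose a ha0 ha using h1
    refine ⟨fun ξ w => a (ι ξ w) ξ, ?_⟩
    refine LinearMap.pi_ext fun b v => ?_
    rw [T_apply, ← ha b v]
    refine Finset.sum_congr rfl fun ξ _ => ?_
    by_cases hex : ∃ w, ι ξ w = b
    · obtain ⟨w, rfl⟩ := hex
      rw [Finset.sum_eq_single w]
      · rw [Pi.single_eq_same]
      · intro w' _ hw'
        rw [Pi.single_eq_of_ne fun h => hw' (hι ξ h), map_zero, mul_zero]
      · simp
    · rw [ha0 b ξ hex, zero_mul]
      refine Finset.sum_eq_zero fun w _ => ?_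
      rw [Pi.single_eq_of_ne fun h => hex ⟨w, h⟩, map_zero, mul_zero]
  let Ψ : (∀ ξ, incidenceKernel ℚ (p ∘ ι ξ) (m ∘ ι ξ)) →ₗ[ℚ]
      (LinearMap.range (differenceMap V p m) ⊔ Submodule.pi Set.univ A).dualAnnihilator :=
    { toFun := fun c => ⟨T fun ξ => (c ξ).1, (T_mem_iff _).2 fun ξ => (c ξ).2⟩
      map_add' := fun a b => Subtype.ext (T.map_add _ _)
      map_smul' := fun r a => Subtype.ext (T.map_smul r _) }
  have hΨ : Function.Bijective Ψ := by
    refine ⟨fun c c' h => ?_, fun θ => ?_⟩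
    · have := T_inj (congrArg Subtype.val h)
      funext ξ
      exact Subtype.ext (congrFun this ξ)
    · obtain ⟨c, hc⟩ := T_surj θ.1 θ.2
      have h := (T_mem_iff c).1 (hc ▸ θ.2)
      exact ⟨fun ξ => ⟨c ξ, h ξ⟩, Subtype.ext hc⟩
  rw [← (LinearEquiv.ofBijective Ψ hΨ).finrank_eq, finrank_pi_fintype]

end LinearAlgebra

/-! ### Forms vanishing on linear subspaces, and evaluation functionals. -/

section Polynomials

variable {n : ℕ}

/-- The homogeneous linear polynomial of a linear form. -/
def linearPolynomial : Dual ℚ (Fin n → ℚ) →ₗ[ℚ] MvPolynomial (Fin n) ℚ where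
  toFun l := ∑ i, MvPolynomial.C (l (Pi.single i 1)) * MvPolynomial.X i
  map_add' l l' := by simp [add_mul, Finset.sum_add_distrib]
  map_smul' c l := by simp [mul_assoc, Finset.mul_sum, MvPolynomial.smul_eq_C_mul]

theorem linearPolynomial_apply (l : Dual ℚ (Fin n → ℚ)) :
    linearPolynomial l = ∑ i, MvPolynomial.C (l (Pi.single i 1)) * MvPolynomial.X i := rfl

@[simp]
theorem eval_linearPolynomial (l : Dual ℚ (Fin n → ℚ)) (x : Fin n → ℚ) :
    MvPolynomial.eval x (linearPolynomial l) = l x := by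
  conv_rhs => rw [LinearMap.pi_apply_eq_sum_univ l x]
  rw [linearPolynomial_apply, map_sum]
  refine Finset.sum_congr rfl fun i _ => ?_
  rw [map_mul, MvPolynomial.eval_C, MvPolynomial.eval_X, smul_eq_mul, mul_comm]
  congr 2
  ext j
  simp [Pi.single_apply, eq_comm]

theorem linearPolynomial_proj (i : Fin n) :
    linearPolynomial (LinearMap.proj i) = MvPolynomial.X i :=
  MvPolynomial.funext fun x => by simp

theorem isHomogeneous_linearPolynomial (l : Dual ℚ (Fin n → ℚ)) :
    (linearPolynomial l).IsHomogeneous 1 :=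
  MvPolynomial.IsHomogeneous.sum _ _ _ fun i _ => MvPolynomial.isHomogeneous_C_mul_X _ i

/-- Substitution of a linear endomorphism into a polynomial. -/
def linearSubst (π : (Fin n → ℚ) →ₗ[ℚ] (Fin n → ℚ)) :
    MvPolynomial (Fin n) ℚ →ₐ[ℚ] MvPolynomial (Fin n) ℚ :=
  MvPolynomial.aeval fun i => linearPolynomial (LinearMap.proj i ∘ₗ π)

theorem eval_linearSubst (π : (Fin n → ℚ) →ₗ[ℚ] (Fin n → ℚ)) (f : MvPolynomial (Fin n) ℚ)
    (x : Fin n → ℚ) : MvPolynomial.eval x (linearSubst π f) = MvPolynomial.eval (π x) f := by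
  induction f using MvPolynomial.induction_on with
  | C a => simp [linearSubst]
  | add p q hp hq => rw [map_add, map_add, hp, hq, map_add]
  | mul_X p i hp =>
    rw [map_mul, map_mul, hp, map_mul]
    simp [linearSubst]

theorem linearSubst_eq_zero_iff {π : (Fin n → ℚ) →ₗ[ℚ] (Fin n → ℚ)}
    {f : MvPolynomial (Fin n) ℚ} :
    linearSubst π f = 0 ↔ ∀ x ∈ LinearMap.range π, MvPolynomial.eval x f = 0 := by
  constructor
  · rintro h _ ⟨x, rfl⟩
    rw [← eval_linearSubst, h, map_zero]
  · intro h
    refine MvPolynomial.funext fun x => ?_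
    rw [eval_linearSubst, h _ ⟨x, rfl⟩, map_zero]

/-- Modulo the linear forms vanishing on the range of π, each variable equals its substituted value,
so the two algebra maps to the quotient agree on generators. -/
theorem sub_linearSubst_mem {π : (Fin n → ℚ) →ₗ[ℚ] (Fin n → ℚ)} (hπ : ∀ x, π (π x) = π x)
    (f : MvPolynomial (Fin n) ℚ) :
    f - linearSubst π f ∈
      Ideal.span (linearPolynomial '' {l | ∀ x ∈ LinearMap.range π, l x = 0}) := by
  set I : Ideal (MvPolynomial (Fin n) ℚ) :=
    Ideal.span (linearPolynomial '' {l | ∀ x ∈ LinearMap.range π, l x = 0}) with hI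
  have h : (Ideal.Quotient.mkₐ ℚ I).comp (linearSubst π) = Ideal.Quotient.mkₐ ℚ I := by
    refine MvPolynomial.algHom_ext fun i => ?_
    symm
    rw [AlgHom.comp_apply, Ideal.Quotient.mkₐ_eq_mk, Ideal.Quotient.eq]
    refine Ideal.subset_span ⟨LinearMap.proj i - LinearMap.proj i ∘ₗ π, ?_, ?_⟩
    · rintro _ ⟨x, rfl⟩
      simp [hπ]
    · rw [map_sub, linearPolynomial_proj]
      simp [linearSubst]
  have h1 := AlgHom.congr_fun h f
  rw [AlgHom.comp_apply, Ideal.Quotient.mkₐ_eq_mk, eq_comm, Ideal.Quotient.eq] at h1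
  exact h1

theorem exists_projection (U : Submodule ℚ (Fin n → ℚ)) :
    ∃ π : (Fin n → ℚ) →ₗ[ℚ] (Fin n → ℚ), LinearMap.range π = U ∧ ∀ x, π (π x) = π x := by
  obtain ⟨g, hg⟩ := U.subtype.exists_leftInverse_of_injective U.ker_subtype
  have hg' : ∀ u : U, g u = u := fun u => LinearMap.congr_fun hg u
  refine ⟨U.subtype ∘ₗ g, ?_, fun x => ?_⟩
  · ext x
    constructor
    · rintro ⟨y, rfl⟩
      exact (g y).2
    · intro hx
      exact ⟨x, congrArg Subtype.val (hg' ⟨x, hx⟩)⟩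
  · exact congrArg Subtype.val (hg' (g x))

/-- A polynomial that vanishes on a linear subspace lies in the ideal generated by the linear
forms that vanish there. -/
theorem mem_span_linearPolynomial (U : Submodule ℚ (Fin n → ℚ)) {f : MvPolynomial (Fin n) ℚ}
    (h : ∀ x ∈ U, MvPolynomial.eval x f = 0) :
    f ∈ Ideal.span (linearPolynomial '' {l | ∀ x ∈ U, l x = 0}) := by
  obtain ⟨π, rfl, hπ⟩ := exists_projection U
  have := sub_linearSubst_mem hπ f
  rwa [linearSubst_eq_zero_iff.2 h, sub_zero] at this

/-- The polynomials vanishing on a linear subspace form a prime ideal. -/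
theorem vanishing_mul {U : Submodule ℚ (Fin n → ℚ)} {f g : MvPolynomial (Fin n) ℚ}
    (h : ∀ x ∈ U, MvPolynomial.eval x (f * g) = 0) (hf : ∃ x ∈ U, MvPolynomial.eval x f ≠ 0) :
    ∀ x ∈ U, MvPolynomial.eval x g = 0 := by
  obtain ⟨π, rfl, -⟩ := exists_projection U
  rw [← linearSubst_eq_zero_iff, map_mul, mul_eq_zero] at h
  rcases h with h | h
  · obtain ⟨x, hx, hne⟩ := hf
    exact absurd (linearSubst_eq_zero_iff.1 h x hx) hne
  · exact linearSubst_eq_zero_iff.1 h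

theorem vanishing_prod {U : Submodule ℚ (Fin n → ℚ)} {ι : Type*} (J : Finset ι)
    (l : ι → MvPolynomial (Fin n) ℚ) (hl : ∀ j ∈ J, ∃ x ∈ U, MvPolynomial.eval x (l j) ≠ 0) :
    ∃ x ∈ U, MvPolynomial.eval x (∏ j ∈ J, l j) ≠ 0 := by
  classical
  induction J using Finset.induction_on with
  | empty => exact ⟨0, zero_mem _, by simp⟩
  | insert j J hj ih =>
    by_contra! hcon
    obtain ⟨x, hx, hne⟩ := ih fun i hi => hl i (Finset.mem_insert_of_mem hi)
    rw [Finset.prod_insert hj] at hcon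
    exact hne (vanishing_mul hcon (hl j (Finset.mem_insert_self _ _)) x hx)

theorem dvd_of_vanishing {l : Dual ℚ (Fin n → ℚ)} {f : MvPolynomial (Fin n) ℚ}
    (h : ∀ x ∈ LinearMap.ker l, MvPolynomial.eval x f = 0) : linearPolynomial l ∣ f := by
  rw [← Ideal.mem_span_singleton]
  refine Ideal.span_le.2 ?_ (mem_span_linearPolynomial _ h)
  rintro _ ⟨l', hl', rfl⟩
  have h1 : l' ∈ Submodule.span ℚ (Set.range fun _ : Unit => l) :=
    mem_span_of_iInf_ker_le_ker fun x hx => hl' x ((Submodule.mem_iInf _).1 hx ())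
  rw [Set.range_const, Submodule.mem_span_singleton] at h1
  obtain ⟨c, rfl⟩ := h1
  rw [map_smul, MvPolynomial.smul_eq_C_mul]
  exact Ideal.mul_mem_left _ _ (Ideal.subset_span rfl)

theorem exists_eq_of_vanishing {l l' : Dual ℚ (Fin n → ℚ)} {f : MvPolynomial (Fin n) ℚ}
    (h : ∀ x ∈ LinearMap.ker l ⊓ LinearMap.ker l', MvPolynomial.eval x f = 0) :
    ∃ a b, f = linearPolynomial l * a + linearPolynomial l' * b := by
  have h2 : f ∈ Ideal.span {linearPolynomial l, linearPolynomial l'} := by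
    refine Ideal.span_le.2 ?_ (mem_span_linearPolynomial _ h)
    rintro _ ⟨l'', hl'', rfl⟩
    have h1 : l'' ∈ Submodule.span ℚ (Set.range ![l, l']) := by
      refine mem_span_of_iInf_ker_le_ker fun x hx => hl'' x ?_
      rw [Submodule.mem_iInf] at hx
      exact ⟨hx 0, hx 1⟩
    rw [Matrix.range_cons, Matrix.range_cons, Matrix.range_empty, Set.union_empty,
      Set.singleton_union, Submodule.mem_span_pair] at h1
    obtain ⟨c, c', rfl⟩ := h1
    rw [map_add, map_smul, map_smul, MvPolynomial.smul_eq_C_mul, MvPolynomial.smul_eq_C_mul]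
    exact add_mem (Ideal.mul_mem_left _ _ (Ideal.subset_span (by simp)))
      (Ideal.mul_mem_left _ _ (Ideal.subset_span (by simp)))
  obtain ⟨a, b, e⟩ := Ideal.mem_span_pair.1 h2
  exact ⟨a, b, by rw [← e]; ring⟩

/-- A polynomial vanishing on the pairwise distinct intersections of a hyperplane `ker l` with
the hyperplanes `ker (l' j)` lies in the ideal generated by `l` and the product of the `l' j`. -/
theorem exists_eq_add_prod {ι : Type*} (l : Dual ℚ (Fin n → ℚ)) (l' : ι → Dual ℚ (Fin n → ℚ))
    (J : Finset ι) (hdist : ∀ i ∈ J, ∀ j ∈ J, i ≠ j →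
      ∃ x ∈ LinearMap.ker l ⊓ LinearMap.ker (l' i), l' j x ≠ 0)
    {f : MvPolynomial (Fin n) ℚ}
    (h : ∀ j ∈ J, ∀ x ∈ LinearMap.ker l ⊓ LinearMap.ker (l' j), MvPolynomial.eval x f = 0) :
    ∃ a b, f = linearPolynomial l * a + (∏ j ∈ J, linearPolynomial (l' j)) * b := by
  classical
  induction J using Finset.induction_on with
  | empty => exact ⟨0, f, by simp⟩
  | insert i J hi ih =>
    obtain ⟨a, b, hab⟩ := ih
      (fun i hi j hj => hdist i (Finset.mem_insert_of_mem hi) j (Finset.mem_insert_of_mem hj))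
      (fun j hj => h j (Finset.mem_insert_of_mem hj))
    -- On the new intersection `l` is zero and the earlier product is not identically zero, so
    -- primality moves the vanishing of `f` to the cofactor `b`.
    have hb : ∀ x ∈ LinearMap.ker l ⊓ LinearMap.ker (l' i), MvPolynomial.eval x b = 0 := by
      refine vanishing_mul (f := ∏ j ∈ J, linearPolynomial (l' j)) (fun x hx => ?_) ?_
      · have h1 := h i (Finset.mem_insert_self _ _) x hx
        have h2 : l x = 0 := hx.1
        rw [hab, map_add, map_mul, eval_linearPolynomial, h2, zero_mul, zero_add] at h1
        exact h1
      · refine vanishing_prod J _ fun j hj => ?_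
        simp only [eval_linearPolynomial]
        exact hdist i (Finset.mem_insert_self _ _) j (Finset.mem_insert_of_mem hj)
          fun e => hi (e ▸ hj)
    obtain ⟨a', b', e⟩ := exists_eq_of_vanishing hb
    refine ⟨a + (∏ j ∈ J, linearPolynomial (l' j)) * a', b', ?_⟩
    rw [Finset.prod_insert hi, hab, e]
    ring

theorem homogeneousComponent_linearPolynomial_mul (l : Dual ℚ (Fin n → ℚ)) (k : ℕ)
    (f : MvPolynomial (Fin n) ℚ) :
    MvPolynomial.homogeneousComponent (k + 1) (linearPolynomial l * f) =
      linearPolynomial l * MvPolynomial.homogeneousComponent k f := by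
  let _ := MvPolynomial.gradedAlgebra (σ := Fin n) (R := ℚ)
  have := DirectSum.coe_decompose_mul_add_of_left_mem
    (MvPolynomial.homogeneousSubmodule (Fin n) ℚ) (j := k) (b := f)
    (isHomogeneous_linearPolynomial l)
  rw [add_comm 1 k] at this
  rwa [← MvPolynomial.decomposition.decompose'_apply, ← MvPolynomial.decomposition.decompose'_apply]

theorem finrank_homogeneousSubmodule (k : ℕ) :
    finrank ℚ (MvPolynomial.homogeneousSubmodule (Fin 3) ℚ k) = (k + 2).choose 2 := by
  classical
  rw [MvPolynomial.homogeneousSubmodule_eq_finsupp_supported]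
  change finrank ℚ (MvPolynomial.restrictSupport ℚ {d : Fin 3 →₀ ℕ | d.degree = k}) = _
  rw [finrank_eq_nat_card_basis (MvPolynomial.basisRestrictSupport ℚ {d : Fin 3 →₀ ℕ | d.degree = k})]
  have h : {d : Fin 3 →₀ ℕ | d.degree = k} = ↑((Finset.univ : Finset (Fin 3)).finsuppAntidiag k) := by
    ext d
    simp [Finsupp.degree_eq_sum, Finset.mem_finsuppAntidiag]
  rw [h, Nat.card_coe_set_eq, Set.ncard_coe_finset, Finset.card_finsuppAntidiag_nat_eq_choose,
    Finset.card_univ, Fintype.card_fin, show 3 + k - 1 = k + 2 by omega]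
  exact Nat.choose_symm_add

/-- The forms of degree `k` that vanish on a subspace. -/
def vanishingForms (k : ℕ) (U : Submodule ℚ (Fin n → ℚ)) :
    Submodule ℚ (MvPolynomial.homogeneousSubmodule (Fin n) ℚ k) where
  carrier := {f | ∀ x ∈ U, MvPolynomial.eval x f.1 = 0}
  add_mem' := by
    intro a b ha hb x hx
    simp [ha x hx, hb x hx]
  zero_mem' := by simp
  smul_mem' := by
    intro c a ha x hx
    simp [ha x hx]

theorem linearPolynomial_ne_zero {l : Dual ℚ (Fin n → ℚ)} (hl : l ≠ 0) :
    linearPolynomial l ≠ 0 := by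
  intro h
  refine hl (LinearMap.ext fun x => ?_)
  rw [← eval_linearPolynomial, h]
  simp

/-- Multiplication by the linear form is an isomorphism from the forms of degree `k`. The quotient
supplied by divisibility need not be presented as homogeneous, so its degree `k` component is taken.
-/
theorem finrank_vanishingForms (k : ℕ) {l : Dual ℚ (Fin n → ℚ)} (hl : l ≠ 0) :
    finrank ℚ (vanishingForms (k + 1) (LinearMap.ker l)) =
      finrank ℚ (MvPolynomial.homogeneousSubmodule (Fin n) ℚ k) := by
  have hhom : ∀ f : MvPolynomial.homogeneousSubmodule (Fin n) ℚ k,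
      (linearPolynomial l * f.1).IsHomogeneous (k + 1) := fun f => by
    rw [add_comm]
    exact (isHomogeneous_linearPolynomial l).mul f.2
  let μ : MvPolynomial.homogeneousSubmodule (Fin n) ℚ k →ₗ[ℚ]
      vanishingForms (k + 1) (LinearMap.ker l) :=
    { toFun := fun f => ⟨⟨linearPolynomial l * f.1, hhom f⟩, fun x hx => by
        have : l x = 0 := hx
        simp [this]⟩
      map_add' := fun f g => by ext1; ext1; simp [mul_add]
      map_smul' := fun c f => by ext1; ext1; simp }
  have hμ : ∀ f, (μ f).1.1 = linearPolynomial l * f.1 := fun _ => rfl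
  refine (LinearEquiv.ofBijective μ ⟨fun f g h => ?_, fun g => ?_⟩).finrank_eq.symm
  · have h1 : linearPolynomial l * f.1 = linearPolynomial l * g.1 := by rw [← hμ, ← hμ, h]
    exact Subtype.ext (mul_left_cancel₀ (linearPolynomial_ne_zero hl) h1)
  · obtain ⟨q, hq⟩ := dvd_of_vanishing g.2
    refine ⟨⟨MvPolynomial.homogeneousComponent k q,
      MvPolynomial.homogeneousComponent_isHomogeneous k q⟩, ?_⟩
    ext1; ext1
    rw [hμ, ← homogeneousComponent_linearPolynomial_mul, ← hq]
    exact MvPolynomial.homogeneousComponent_eq_self g.1.2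

/-- Suppose the functionals `φ j` on forms of degree `k + 1` sum to zero and that `φ j` kills the
forms vanishing on a hyperplane `ker (l j)`. If the intersections of `ker (l i)` with the other
hyperplanes are distinct, then `φ i` kills the forms vanishing on these intersections. -/
theorem functional_eq_zero_of_sum_eq_zero {ι : Type*} [DecidableEq ι] (k : ℕ) (J : Finset ι)
    (l : ι → Dual ℚ (Fin n → ℚ))
    (φ : ι → Dual ℚ (MvPolynomial.homogeneousSubmodule (Fin n) ℚ (k + 1)))
    (hφ : ∀ j ∈ J, ∀ f ∈ vanishingForms (k + 1) (LinearMap.ker (l j)), φ j f = 0)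
    (hsum : ∀ f, ∑ j ∈ J, φ j f = 0) {i : ι} (hi : i ∈ J)
    (hdist : ∀ j ∈ J.erase i, ∀ j' ∈ J.erase i, j ≠ j' →
      ∃ x ∈ LinearMap.ker (l i) ⊓ LinearMap.ker (l j), l j' x ≠ 0)
    (f : MvPolynomial.homogeneousSubmodule (Fin n) ℚ (k + 1))
    (hf : ∀ j ∈ J.erase i, ∀ x ∈ LinearMap.ker (l i) ⊓ LinearMap.ker (l j),
      MvPolynomial.eval x f.1 = 0) : φ i f = 0 := by
  obtain ⟨a, b, hab⟩ := exists_eq_add_prod (l i) l (J.erase i) hdist hf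
  let comp : MvPolynomial (Fin n) ℚ → MvPolynomial.homogeneousSubmodule (Fin n) ℚ (k + 1) :=
    fun g => ⟨MvPolynomial.homogeneousComponent (k + 1) g,
      MvPolynomial.homogeneousComponent_isHomogeneous (k + 1) g⟩
  have kill : ∀ j ∈ J, ∀ g, linearPolynomial (l j) ∣ g → φ j (comp g) = 0 := by
    rintro j hj _ ⟨q, rfl⟩
    refine hφ j hj _ fun x hx => ?_
    have h0 : l j x = 0 := hx
    change MvPolynomial.eval x (MvPolynomial.homogeneousComponent (k + 1) _) = 0
    rw [homogeneousComponent_linearPolynomial_mul, map_mul, eval_linearPolynomial, h0, zero_mul]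
  have hsplit : f = comp (linearPolynomial (l i) * a) +
      comp ((∏ j ∈ J.erase i, linearPolynomial (l j)) * b) := by
    ext1
    change f.1 = MvPolynomial.homogeneousComponent (k + 1) _ +
      MvPolynomial.homogeneousComponent (k + 1) _
    rw [← map_add, ← hab]
    exact (MvPolynomial.homogeneousComponent_eq_self f.2).symm
  have hprod := hsum (comp ((∏ j ∈ J.erase i, linearPolynomial (l j)) * b))
  -- The product is divisible by every `l j` with `j ≠ i`, so the zero-sum relation at it reduces to
  -- its `φ i` term.
  rw [← Finset.add_sum_erase _ _ hi, Finset.sum_eq_zero (s := J.erase i), add_zero] at hprod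
  · rw [hsplit, map_add, kill i hi _ (dvd_mul_right _ _), hprod, add_zero]
  · intro j hj
    exact kill j (Finset.mem_of_mem_erase hj) _ ((Finset.dvd_prod_of_mem _ hj).mul_right b)

/-- Evaluation at a point, as a functional on the forms of degree `k`. -/
def evalForm (k : ℕ) (v : Fin n → ℚ) : Dual ℚ (MvPolynomial.homogeneousSubmodule (Fin n) ℚ k) :=
  (MvPolynomial.aeval v).toLinearMap ∘ₗ (MvPolynomial.homogeneousSubmodule (Fin n) ℚ k).subtype

@[simp]
theorem evalForm_apply (k : ℕ) (v : Fin n → ℚ)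
    (f : MvPolynomial.homogeneousSubmodule (Fin n) ℚ k) :
    evalForm k v f = MvPolynomial.eval v f.1 := by
  simp [evalForm, MvPolynomial.aeval_eq_eval]

/-- For each ξ, a product of linear forms nonzero at `v ξ`, one of which vanishes at each other
point, isolates the coefficient of ξ. It has one factor per point, padded to degree `k` by a power
of `l₀`; hence the bound on `k`. -/
theorem linearIndependent_evalForm {Ξ : Type*} [Fintype Ξ] {k : ℕ} (hk : Fintype.card Ξ ≤ k)
    (v : Ξ → Fin n → ℚ) (hv : ∀ ξ ξ', ξ ≠ ξ' → v ξ ∉ Submodule.span ℚ {v ξ'})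
    (hv0 : ∀ ξ, v ξ ≠ 0) : LinearIndependent ℚ fun ξ => evalForm k (v ξ) := by
  classical
  rw [Fintype.linearIndependent_iff]
  intro c hc ξ
  have sep : ∀ ξ', ξ ≠ ξ' → ∃ l : Dual ℚ (Fin n → ℚ), l (v ξ') = 0 ∧ l (v ξ) ≠ 0 := by
    intro ξ' h
    obtain ⟨l, h1, h2⟩ := Submodule.exists_le_ker_of_notMem (hv ξ ξ' h)
    exact ⟨l, h2 (Submodule.mem_span_singleton_self _), h1⟩
  have sep0 : ∃ l : Dual ℚ (Fin n → ℚ), l (v ξ) ≠ 0 := by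
    obtain ⟨l, h1, -⟩ := Submodule.exists_le_ker_of_notMem
      (p := (⊥ : Submodule ℚ (Fin n → ℚ))) (v := v ξ) (by simpa using hv0 ξ)
    exact ⟨l, h1⟩
  obtain ⟨l₀, hl₀⟩ := sep0
  have hl : ∀ ξ', ∃ l : Dual ℚ (Fin n → ℚ), (ξ ≠ ξ' → l (v ξ') = 0) ∧ l (v ξ) ≠ 0 := by
    intro ξ'
    by_cases h : ξ = ξ'
    · exact ⟨l₀, fun h' => absurd h h', hl₀⟩
    · obtain ⟨l, h1, h2⟩ := sep ξ' h
      exact ⟨l, fun _ => h1, h2⟩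
  choose l hl1 hl2 using hl
  let f : MvPolynomial (Fin n) ℚ := (∏ ξ', linearPolynomial (l ξ')) *
    linearPolynomial l₀ ^ (k - Fintype.card Ξ)
  have hf : f.IsHomogeneous k := by
    have h1 := (MvPolynomial.IsHomogeneous.prod Finset.univ (fun ξ' => linearPolynomial (l ξ'))
      (fun _ => 1) fun _ _ => isHomogeneous_linearPolynomial _).mul
      ((isHomogeneous_linearPolynomial l₀).pow (k - Fintype.card Ξ))
    convert h1 using 1
    simp
    omega
  have h := LinearMap.congr_fun hc ⟨f, hf⟩
  simp only [LinearMap.sum_apply, LinearMap.smul_apply, evalForm_apply, smul_eq_mul,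
    LinearMap.zero_apply] at h
  rw [Finset.sum_eq_single ξ] at h
  · refine (mul_eq_zero.1 h).resolve_right ?_
    simp only [f, map_mul, map_prod, map_pow, eval_linearPolynomial]
    exact mul_ne_zero (Finset.prod_ne_zero_iff.2 fun ξ' _ => hl2 ξ') (pow_ne_zero _ hl₀)
  · intro ξ' _ hne
    simp only [f, map_mul, map_prod, map_pow, eval_linearPolynomial]
    rw [Finset.prod_eq_zero (Finset.mem_univ ξ') (hl1 ξ' hne.symm), zero_mul, mul_zero]
  · simp

end Polynomials

/-! ### From cones to spans, and from points to lines. -/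

section Vanishing

variable {n : ℕ}

theorem MvPolynomial.IsHomogeneous.eval_smul_eq {k : ℕ} {f : MvPolynomial (Fin n) ℚ}
    (hf : f.IsHomogeneous k) (t : ℚ) (v : Fin n → ℚ) :
    MvPolynomial.eval (t • v) f = t ^ k * MvPolynomial.eval v f := by
  rw [MvPolynomial.eval_eq', MvPolynomial.eval_eq', Finset.mul_sum]
  refine Finset.sum_congr rfl fun d hd => ?_
  have h1 : ∑ i, d i = k := by
    rw [← Finsupp.degree_eq_sum]
    by_contra h
    exact MvPolynomial.mem_support_iff.1 hd (hf.coeff_eq_zero h)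
  simp only [Pi.smul_apply, smul_eq_mul, mul_pow, Finset.prod_mul_distrib, Finset.prod_pow_eq_pow_sum,
    h1]
  ring

/-- For a, b in the cone, f(a + t b) is a polynomial in t with zeros at all t ≥ 0, so it is zero, in
particular at t = −1. -/
theorem eval_eq_zero_of_mem_coneSpan {σ : PointedCone ℚ (Fin n → ℚ)} {f : MvPolynomial (Fin n) ℚ}
    (h : ∀ x ∈ σ, MvPolynomial.eval x f = 0) :
    ∀ x ∈ coneSpan σ, MvPolynomial.eval x f = 0 := by
  intro x hx
  obtain ⟨a, ha, b, hb, rfl⟩ := mem_coneSpan_iff.1 hx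
  let q : Polynomial ℚ :=
    MvPolynomial.aeval (fun i => Polynomial.C (a i) + Polynomial.X * Polynomial.C (b i)) f
  have hq : ∀ t : ℚ, q.eval t = MvPolynomial.eval (a + t • b) f := by
    intro t
    have h1 : ((Polynomial.aeval t).comp (MvPolynomial.aeval
        (fun i => Polynomial.C (a i) + Polynomial.X * Polynomial.C (b i)))) =
        MvPolynomial.aeval (R := ℚ) (a + t • b) := by
      refine MvPolynomial.algHom_ext fun i => ?_
      simp [mul_comm t]
    have h2 := AlgHom.congr_fun h1 f
    rw [MvPolynomial.aeval_eq_eval] at h2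
    rw [← Polynomial.coe_aeval_eq_eval]
    exact h2
  have hq0 : q = 0 := by
    refine Polynomial.eq_zero_of_infinite_isRoot q (Set.Infinite.mono ?_ (Set.Ici_infinite (0 : ℚ)))
    intro t ht
    change q.eval t = 0
    rw [hq]
    exact h _ (add_mem ha (σ.smul_mem ht hb))
  have := hq (-1)
  rw [hq0, Polynomial.eval_zero, neg_one_smul, ← sub_eq_add_neg] at this
  exact this.symm

theorem exists_eq_span_singleton {ξ : Submodule ℚ (Fin n → ℚ)} (h : finrank ℚ ξ = 1) :
    ∃ v, v ≠ 0 ∧ ξ = Submodule.span ℚ {v} := by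
  obtain ⟨v, hv, hne⟩ := Submodule.exists_mem_ne_zero_of_ne_bot
    (p := ξ) (by rintro rfl; simp at h)
  refine ⟨v, hne, (Submodule.eq_of_le_of_finrank_eq ?_ ?_).symm⟩
  · rwa [Submodule.span_singleton_le_iff_mem]
  · rw [h, finrank_span_singleton hne]

theorem graphBettiOne_eq_zero {V : Type*} [Fintype V] (G : SimpleGraph V)
    (h : ∀ v w, ¬ G.Adj v w) : graphBettiOne G = 0 := by
  have : Subsingleton (graphOneChains G) :=
    ⟨fun a b => Subtype.ext (by funext v w; rw [a.2.2 v w (h v w), b.2.2 v w (h v w)])⟩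
  exact finrank_zero_of_subsingleton

end Vanishing

/-! ### Splines on three-dimensional hereditary fans. -/

namespace PolyhedralFan

theorem eq_of_isBoundary {d : ℕ} {F : PolyhedralFan d} {τ : PointedCone ℚ (Fin d → ℚ)}
    (hd : coneDim τ + 1 = d) (hb : F.IsBoundary τ) {α α' : PointedCone ℚ (Fin d → ℚ)}
    (hα : α ∈ F.faces d) (hα' : α' ∈ F.faces d) (h : τ.IsFaceOf α) (h' : τ.IsFaceOf α') :
    α = α' := by
  obtain ⟨τ', -, hd', hu, hf⟩ := hb
  have e : τ = τ' := hf.eq_of_coneSpan_eq .rfl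
    ((coneSpan_le_iff_eq (by omega)).1 (coneSpan_mono hf.le))
  subst e
  exact hu.unique ⟨hα, h⟩ ⟨hα', h'⟩

theorem not_isBoundary_of_mem_faces {d : ℕ} {F : PolyhedralFan d}
    {α : PointedCone ℚ (Fin d → ℚ)} (hα : α ∈ F.faces d) : ¬ F.IsBoundary α := by
  rintro ⟨τ, -, hd, -, hf⟩
  have h1 := Submodule.finrank_mono (coneSpan_mono hf.le)
  have h2 := hα.2
  unfold coneDim at hd h2
  omega

/-- A choice of orientation of the interior codimension one cones `b`, by naming the two
full-dimensional cones `p b` and `m b` that contain `b`. -/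
structure IsOrientation (F : PolyhedralFan 3) (p m : F.interiorFaces 2 → F.faces 3) : Prop where
  ne : ∀ b, p b ≠ m b
  isFaceOf_iff : ∀ b s, b.1.IsFaceOf s.1 ↔ p b = s ∨ m b = s

variable {F : PolyhedralFan 3}

theorem exists_isOrientation (hF : F.IsHereditary) :
    ∃ p m : F.interiorFaces 2 → F.faces 3, F.IsOrientation p m := by
  have h : ∀ b : F.interiorFaces 2, ∃ p m : F.faces 3, p ≠ m ∧
      ∀ s : F.faces 3, b.1.IsFaceOf s.1 ↔ p = s ∨ m = s := by
    intro b
    obtain ⟨α, hα, α', hα', hne, f, f', hall⟩ :=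
      F.exists_two_cones hF b.2.1.1 (by rw [b.2.1.2]) b.2.2
    refine ⟨⟨α, hα⟩, ⟨α', hα'⟩, fun e => hne (congrArg Subtype.val e), fun s => ⟨fun hs => ?_, ?_⟩⟩
    · rcases hall s.1 s.2 hs with h | h
      · exact Or.inl (Subtype.ext h.symm)
      · exact Or.inr (Subtype.ext h.symm)
    · rintro (rfl | rfl)
      · exact f
      · exact f'
  choose p m h1 h2 using h
  exact ⟨p, m, h1, h2⟩

instance (F : PolyhedralFan 3) (i : ℕ) : Finite (F.faces i) :=
  (F.cones.finite_toSet.subset fun _ h => h.1).to_subtype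

instance (F : PolyhedralFan 3) (i : ℕ) : Finite (F.interiorFaces i) :=
  (F.cones.finite_toSet.subset fun _ h => h.1.1).to_subtype

theorem coneDim_interiorFace (b : F.interiorFaces 2) : coneDim b.1 + 1 = 3 := by
  rw [b.2.1.2]

/-- A vertex of `G_ξ(Σ)`, as an interior two-dimensional cone. -/
def vertexCone {ξ : Submodule ℚ (Fin 3 → ℚ)} (w : F.GraphVertex 1 ξ) : F.interiorFaces 2 :=
  ⟨w.1, w.2.1⟩

theorem vertexCone_injective {ξ : Submodule ℚ (Fin 3 → ℚ)} :
    Function.Injective (vertexCone (F := F) (ξ := ξ)) := fun _ _ h =>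
  Subtype.ext (Subtype.mk.inj h)

theorem IsOrientation.coneSpan_ne {p m : F.interiorFaces 2 → F.faces 3} (ho : F.IsOrientation p m)
    {b b' : F.interiorFaces 2} {s : F.faces 3} (hne : b ≠ b') (h : p b = s ∨ m b = s)
    (h' : p b' = s ∨ m b' = s) : coneSpan b.1 ≠ coneSpan b'.1 := fun e =>
  hne (Subtype.ext (((ho.isFaceOf_iff b s).2 h).eq_of_coneSpan_eq ((ho.isFaceOf_iff b' s).2 h') e))

/-- The vertices of G_ξ are edges of the dual graph of the fan, adjacent when they share a maximal
cone: the condition on the intersection of spans is then automatic by dimension. Two maximal cones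
share at most one facet, and at most two facets of one cone have spans through ξ, so the comparison
with the incidence kernel applies. -/
theorem betti_eq_finrank {p m : F.interiorFaces 2 → F.faces 3} (ho : F.IsOrientation p m)
    (ξ : {ξ : Submodule ℚ (Fin 3 → ℚ) // finrank ℚ ξ + 2 = 3}) :
    F.betti ξ = finrank ℚ (incidenceKernel ℚ
      (p ∘ vertexCone (F := F) (ξ := ξ.1)) (m ∘ vertexCone (F := F) (ξ := ξ.1))) := by
  have vne : ∀ {w w' : F.GraphVertex 1 ξ.1}, w ≠ w' → vertexCone w ≠ vertexCone w' :=
    fun h => vertexCone_injective.ne h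
  refine graphBettiOne_eq_finrank_incidenceKernel (F.graph 1 ξ.1) (fun w => ho.ne _) ?_ ?_ ?_
  · intro w w'
    constructor
    · rintro ⟨hne, -, α, hα, f, f'⟩
      exact ⟨hne, ⟨α, hα.1⟩, (ho.isFaceOf_iff (vertexCone w) ⟨α, hα.1⟩).1 f,
        (ho.isFaceOf_iff (vertexCone w') ⟨α, hα.1⟩).1 f'⟩
    · rintro ⟨hne, s, h, h'⟩
      refine ⟨hne, ?_, s.1, ⟨s.2, not_isBoundary_of_mem_faces s.2⟩,
        (ho.isFaceOf_iff (vertexCone w) s).2 h, (ho.isFaceOf_iff (vertexCone w') s).2 h'⟩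
      refine Submodule.eq_of_le_of_finrank_eq (le_inf w.2.2 w'.2.2) ?_
      have h1 := finrank_inf_of_ne (coneDim_interiorFace (vertexCone w))
        (coneDim_interiorFace (vertexCone w')) (ho.coneSpan_ne (vne hne) h h')
      have h2 := ξ.2
      change finrank ℚ ξ.1 = finrank ℚ (coneSpan (vertexCone w).1 ⊓ coneSpan (vertexCone w').1 :
        Submodule ℚ (Fin 3 → ℚ))
      omega
  · intro w w' s s' hne h1 h2 h3 h4
    exact Subtype.ext (F.eq_of_two_facets s.2 s'.2 (coneDim_interiorFace (vertexCone w))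
      (coneDim_interiorFace (vertexCone w')) ((ho.isFaceOf_iff _ s).2 h1)
      ((ho.isFaceOf_iff _ s').2 h3) ((ho.isFaceOf_iff _ s).2 h2) ((ho.isFaceOf_iff _ s').2 h4)
      fun e => vne hne (Subtype.ext e))
  · intro s w₁ w₂ w₃ n₁₂ n₁₃ n₂₃ h₁ h₂ h₃
    exact not_three_facets ((ho.isFaceOf_iff _ s).2 h₁) ((ho.isFaceOf_iff _ s).2 h₂)
      ((ho.isFaceOf_iff _ s).2 h₃) (coneDim_interiorFace (vertexCone w₁))
      (coneDim_interiorFace (vertexCone w₂)) (coneDim_interiorFace (vertexCone w₃))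
      (fun e => vne n₁₂ (Subtype.ext e)) (fun e => vne n₁₃ (Subtype.ext e))
      (fun e => vne n₂₃ (Subtype.ext e)) ξ.2 w₁.2.2 w₂.2.2 w₃.2.2

/-- The lines in which the spans of two interior two-dimensional cones meet. -/
def meetingLines (F : PolyhedralFan 3) :
    Set {ξ : Submodule ℚ (Fin 3 → ℚ) // finrank ℚ ξ + 2 = 3} :=
  {ξ | ∃ b b' : F.interiorFaces 2, ξ.1 = coneSpan b.1 ⊓ coneSpan b'.1}

theorem finite_meetingLines (F : PolyhedralFan 3) : F.meetingLines.Finite := by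
  refine Set.Finite.of_finite_image (f := Subtype.val) ?_ Subtype.val_injective.injOn
  refine (Set.finite_range fun z : F.interiorFaces 2 × F.interiorFaces 2 =>
    coneSpan z.1.1 ⊓ coneSpan z.2.1).subset ?_
  rintro _ ⟨ξ, ⟨b, b', e⟩, rfl⟩
  exact ⟨(b, b'), e.symm⟩

theorem support_betti_subset (F : PolyhedralFan 3) :
    Function.support F.betti ⊆ F.meetingLines := by
  intro ξ hξ
  by_contra hcon
  refine hξ (graphBettiOne_eq_zero _ fun w w' hadj => hcon ?_)
  exact ⟨vertexCone w, vertexCone w', hadj.2.1⟩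

/-- Agreement on a cone is agreement on its span. A boundary cone of dimension two lies in a single
maximal cone and imposes no condition. -/
theorem finrank_splinesOfDegree_eq {p m : F.interiorFaces 2 → F.faces 3}
    (ho : F.IsOrientation p m) (k : ℕ) :
    finrank ℚ (F.splinesOfDegree k) =
      finrank ℚ ((Submodule.pi Set.univ fun b : F.interiorFaces 2 =>
        vanishingForms k (coneSpan b.1)).comap
          (differenceMap (MvPolynomial.homogeneousSubmodule (Fin 3) ℚ k) p m)) := by
  have hmem : ∀ f : F.faces 3 → MvPolynomial.homogeneousSubmodule (Fin 3) ℚ k,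
      (fun s => (f s).1) ∈ F.splines ↔ ∀ b : F.interiorFaces 2, ∀ x ∈ coneSpan b.1,
        MvPolynomial.eval x ((f (p b)).1 - (f (m b)).1) = 0 := by
    intro f
    constructor
    · intro h b
      refine eval_eq_zero_of_mem_coneSpan fun x hx => ?_
      rw [map_sub, sub_eq_zero]
      exact h _ _ b.1 b.2.1.1 (coneDim_interiorFace b) ((ho.isFaceOf_iff b _).2 (Or.inl rfl))
        ((ho.isFaceOf_iff b _).2 (Or.inr rfl)) x hx
    · intro h α α' τ hτ hd f1 f2 x hx
      by_cases hb : F.IsBoundary τ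
      · rw [Subtype.ext (eq_of_isBoundary hd hb α.2 α'.2 f1 f2)]
      · let b : F.interiorFaces 2 := ⟨τ, ⟨hτ, by omega⟩, hb⟩
        have h0 := h b x (mem_coneSpan_of_mem hx)
        rw [map_sub, sub_eq_zero] at h0
        rcases (ho.isFaceOf_iff b α).1 f1 with rfl | rfl <;>
          rcases (ho.isFaceOf_iff b α').1 f2 with e | e <;> rw [← e]
        · exact h0
        · exact h0.symm
  let e : F.splinesOfDegree k ≃ₗ[ℚ] ((Submodule.pi Set.univ fun b : F.interiorFaces 2 =>
        vanishingForms k (coneSpan b.1)).comap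
          (differenceMap (MvPolynomial.homogeneousSubmodule (Fin 3) ℚ k) p m)) :=
    { toFun := fun f => ⟨fun s => ⟨f.1 s, f.2.2 s trivial⟩, fun b _ =>
        (hmem fun s => ⟨f.1 s, f.2.2 s trivial⟩).1 f.2.1 b⟩
      map_add' := fun _ _ => rfl
      map_smul' := fun _ _ => rfl
      invFun := fun f => ⟨fun s => (f.1 s).1, (hmem f.1).2 fun b => f.2 b trivial,
        fun s _ => (f.1 s).2⟩
      left_inv := fun _ => rfl
      right_inv := fun _ => rfl }
  exact e.finrank_eq

/-- Only the maximal cone `p b` is used. Testing θ on families supported there makes the signed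
components at its interior facets sum to zero, so the component at `b` is controlled by the lines
where the span of `b` meets those of the other interior facets. -/
theorem comp_single_mem_span {p m : F.interiorFaces 2 → F.faces 3} (ho : F.IsOrientation p m)
    [Fintype (F.interiorFaces 2)] [DecidableEq (F.interiorFaces 2)] (k : ℕ)
    (v : F.meetingLines → Fin 3 → ℚ) (hv : ∀ ξ, ξ.1.1 = Submodule.span ℚ {v ξ})
    {θ : Dual ℚ (F.interiorFaces 2 → MvPolynomial.homogeneousSubmodule (Fin 3) ℚ (k + 1))}
    (hθ : θ ∈ (LinearMap.range
      (differenceMap (MvPolynomial.homogeneousSubmodule (Fin 3) ℚ (k + 1)) p m) ⊔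
        Submodule.pi Set.univ fun b : F.interiorFaces 2 =>
          vanishingForms (k + 1) (coneSpan b.1)).dualAnnihilator) (b : F.interiorFaces 2) :
    θ ∘ₗ LinearMap.single ℚ
        (fun _ => MvPolynomial.homogeneousSubmodule (Fin 3) ℚ (k + 1)) b ∈
      Submodule.span ℚ ((fun ξ => evalForm (k + 1) (v ξ)) ''
        {ξ | ∃ w : F.GraphVertex 1 ξ.1.1, vertexCone w = b}) := by
  classical
  rw [Submodule.dualAnnihilator_sup_eq, Submodule.mem_inf, Submodule.mem_dualAnnihilator,
    Submodule.mem_dualAnnihilator] at hθ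
  obtain ⟨hrange, hkill⟩ := hθ
  choose l hl using fun b : F.interiorFaces 2 => exists_ker_eq (coneDim_interiorFace b)
  let s := p b
  let J : Finset (F.interiorFaces 2) := Finset.univ.filter fun b' => p b' = s ∨ m b' = s
  have memJ : ∀ {b'}, b' ∈ J → p b' = s ∨ m b' = s := fun h => (Finset.mem_filter.1 h).2
  have hbJ : b ∈ J := Finset.mem_filter.2 ⟨Finset.mem_univ _, Or.inl rfl⟩
  let φ : F.interiorFaces 2 → Dual ℚ (MvPolynomial.homogeneousSubmodule (Fin 3) ℚ (k + 1)) :=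
    fun b' => incidenceSign ℚ p m b' s • (θ ∘ₗ LinearMap.single ℚ
      (fun _ => MvPolynomial.homogeneousSubmodule (Fin 3) ℚ (k + 1)) b')
  have hφ_apply : ∀ b' f, φ b' f = incidenceSign ℚ p m b' s * θ (Pi.single b' f) :=
    fun _ _ => rfl
  have hφb : θ ∘ₗ LinearMap.single ℚ
      (fun _ => MvPolynomial.homogeneousSubmodule (Fin 3) ℚ (k + 1)) b = φ b := by
    simp only [φ, s, incidenceSign_of_left ho.ne, one_smul]
  have hφ : ∀ j ∈ J, ∀ f ∈ vanishingForms (k + 1) (LinearMap.ker (l j)), φ j f = 0 := by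
    intro j _ f hf
    rw [hφ_apply, hkill, mul_zero]
    intro b' _
    by_cases e : b' = j
    · subst e
      rw [Pi.single_eq_same]
      rw [hl] at hf
      exact hf
    · rw [Pi.single_eq_of_ne e]
      exact zero_mem _
  have hsum : ∀ f, ∑ j ∈ J, φ j f = 0 := by
    intro f
    rw [← hrange _ ⟨Pi.single s f, rfl⟩, Finset.sum_filter_of_ne]
    · conv_rhs => rw [← Finset.univ_sum_single (differenceMap _ p m (Pi.single s f)), map_sum]
      refine Finset.sum_congr rfl fun b' _ => ?_
      rw [hφ_apply, ← smul_eq_mul, ← map_smul, ← Pi.single_smul]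
      congr 2
      rw [differenceMap_apply, incidenceSign, sub_smul, Pi.single_apply, Pi.single_apply]
      congr 1 <;> split_ifs <;> simp
    · intro b' _ hne
      by_contra hcon
      exact hne (by rw [hφ_apply, incidenceSign_eq_zero hcon, zero_mul])
  have line : ∀ b' : {b' // b' ∈ J.erase b}, ∃ ξ : F.meetingLines,
      ξ.1.1 = coneSpan b.1 ⊓ coneSpan b'.1.1 := by
    rintro ⟨b', hb'⟩
    have hne := ho.coneSpan_ne (Finset.ne_of_mem_erase hb').symm (memJ hbJ)
      (memJ (Finset.mem_of_mem_erase hb'))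
    exact ⟨⟨⟨_, finrank_inf_of_ne (coneDim_interiorFace b) (coneDim_interiorFace b') hne⟩,
      b, b', rfl⟩, rfl⟩
  choose ξ hξ using line
  have hmain : φ b ∈ Submodule.span ℚ (Set.range fun b' => evalForm (k + 1) (v (ξ b'))) := by
    -- Membership in the span of finitely many functionals reduces to vanishing on their common
    -- kernel: the forms vanishing at all chosen points, hence on the lines through them.
    refine mem_span_of_iInf_ker_le_ker fun f hf => ?_
    rw [Submodule.mem_iInf] at hf
    refine functional_eq_zero_of_sum_eq_zero k J l φ hφ hsum hbJ ?_ f ?_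
    · intro j hj j' hj' hne
      by_contra! hcon
      have e := finrank_inf_of_ne (coneDim_interiorFace b) (coneDim_interiorFace j)
        (ho.coneSpan_ne (Finset.ne_of_mem_erase hj).symm (memJ hbJ)
          (memJ (Finset.mem_of_mem_erase hj)))
      -- If two of the lines coincided, three facets of `s` would have spans containing a common
      -- line.
      refine not_three_facets ((ho.isFaceOf_iff b s).2 (memJ hbJ))
        ((ho.isFaceOf_iff j s).2 (memJ (Finset.mem_of_mem_erase hj)))
        ((ho.isFaceOf_iff j' s).2 (memJ (Finset.mem_of_mem_erase hj')))
        (coneDim_interiorFace b) (coneDim_interiorFace j) (coneDim_interiorFace j')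
        (fun e => Finset.ne_of_mem_erase hj (Subtype.ext e.symm))
        (fun e => Finset.ne_of_mem_erase hj' (Subtype.ext e.symm))
        (fun e => hne (Subtype.ext e)) e inf_le_left inf_le_right fun x hx => ?_
      rw [← hl, LinearMap.mem_ker]
      refine hcon x ?_
      rwa [hl, hl]
    · intro j hj x hx
      rw [hl, hl, ← hξ ⟨j, hj⟩, hv, Submodule.mem_span_singleton] at hx
      obtain ⟨t, rfl⟩ := hx
      have h0 := hf ⟨j, hj⟩
      rw [LinearMap.mem_ker, evalForm_apply] at h0
      rw [MvPolynomial.IsHomogeneous.eval_smul_eq f.2, h0, mul_zero]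
  rw [hφb]
  refine Submodule.span_mono ?_ hmain
  rintro _ ⟨b', rfl⟩
  exact ⟨ξ b', ⟨⟨b.1, b.2, by rw [hξ]; exact inf_le_left⟩, rfl⟩, rfl⟩

theorem finrank_vanishingForms_interiorFace (b : F.interiorFaces 2) (k : ℕ) :
    finrank ℚ (vanishingForms (k + 1) (coneSpan b.1)) = (k + 2).choose 2 := by
  obtain ⟨l, hl⟩ := exists_ker_eq (coneDim_interiorFace b)
  rw [← hl, finrank_vanishingForms, finrank_homogeneousSubmodule]
  rintro rfl
  have := coneDim_interiorFace b
  unfold coneDim at this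
  rw [← hl, LinearMap.ker_zero, finrank_top, finrank_fin_fun] at this
  omega

/-- The rank-nullity count in degree `k + 1`, with negative terms moved across. The bound `hk` makes
the evaluations at the meeting lines independent. -/
theorem finrank_splinesOfDegree_add (hF : F.IsHereditary) {k : ℕ}
    (hk : F.meetingLines.ncard ≤ k + 1) :
    finrank ℚ (F.splinesOfDegree (k + 1)) + F.numInteriorFaces 2 * (k + 3).choose 2 =
      F.numFaces 3 * (k + 3).choose 2 + F.numInteriorFaces 2 * (k + 2).choose 2 +
        ∑ ξ ∈ F.finite_meetingLines.toFinset, F.betti ξ := by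
  classical
  obtain ⟨p, m, ho⟩ := exists_isOrientation hF
  let _ : Fintype (F.interiorFaces 2) := Fintype.ofFinite _
  let _ : Fintype (F.faces 3) := Fintype.ofFinite _
  let _ : Fintype F.meetingLines := F.finite_meetingLines.fintype
  have : FiniteDimensional ℚ (MvPolynomial.homogeneousSubmodule (Fin 3) ℚ (k + 1)) :=
    Module.Finite.iff_fg.2 (MvPolynomial.homogeneousSubmodule_fg (σ := Fin 3) (R := ℚ) (k + 1))
  have hline : ∀ ξ : F.meetingLines, ∃ v, v ≠ 0 ∧ ξ.1.1 = Submodule.span ℚ {v} := fun ξ =>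
    exists_eq_span_singleton (by have := ξ.1.2; omega)
  choose v hv0 hv using hline
  have hvne : ∀ ξ ξ', ξ ≠ ξ' → v ξ ∉ Submodule.span ℚ {v ξ'} := by
    intro ξ ξ' hne hmem
    refine hne (Subtype.ext (Subtype.ext (Submodule.eq_of_le_of_finrank_eq ?_ ?_)))
    · rwa [hv ξ, hv ξ', Submodule.span_singleton_le_iff_mem]
    · have h1 := ξ.1.2
      have h2 := ξ'.1.2
      omega
  have hcard : Fintype.card F.meetingLines ≤ k + 1 := by
    rwa [← Nat.card_eq_fintype_card, Nat.card_coe_set_eq]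
  have h1 := finrank_comap_add
    (differenceMap (MvPolynomial.homogeneousSubmodule (Fin 3) ℚ (k + 1)) p m)
    (Submodule.pi Set.univ fun b : F.interiorFaces 2 => vanishingForms (k + 1) (coneSpan b.1))
  rw [finrank_dualAnnihilator_eq_sum_incidenceKernel p m _
    (fun ξ : F.meetingLines => evalForm (k + 1) (v ξ))
    (linearIndependent_evalForm hcard v hvne hv0)
    (fun ξ => F.GraphVertex 1 ξ.1.1) (fun ξ => vertexCone) (fun ξ => vertexCone_injective)
    (fun ξ w a ha => by
      rw [evalForm_apply]
      refine ha _ (w.2.2 ?_)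
      rw [hv]
      exact Submodule.mem_span_singleton_self _)
    (fun θ hθ b => comp_single_mem_span ho k v hv hθ b),
    ← finrank_splinesOfDegree_eq ho, finrank_pi_fintype, finrank_pi_fintype,
    finrank_submodule_pi] at h1
  simp only [finrank_homogeneousSubmodule, finrank_vanishingForms_interiorFace, Finset.sum_const,
    Finset.card_univ, smul_eq_mul, ← betti_eq_finrank ho] at h1
  rw [← Nat.card_eq_fintype_card, ← Nat.card_eq_fintype_card, Nat.card_coe_set_eq,
    Nat.card_coe_set_eq] at h1
  rw [← Finset.sum_coe_sort]
  unfold numFaces numInteriorFaces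
  rw [h1]
  congr 1
  refine Fintype.sum_equiv (Equiv.subtypeEquivRight fun ξ => by simp) _ _ fun ξ => rfl

end PolyhedralFan

end

theorem corollary2p9 (F : PolyhedralFan 3) (hF : F.IsHereditary) :
    (Function.support F.betti).Finite ∧
    ∃ P : Polynomial ℚ, F.IsHilbertPolynomial P ∧
      ∀ k : ℕ, P.eval (k : ℚ) =
        (F.numFaces 3 : ℚ) * ((k + 2).choose 2 : ℚ) - (F.numInteriorFaces 2 : ℚ) * ((k : ℚ) + 1)
          + (F.numInteriorFaces 1 : ℚ) + (F.alphaOne : ℚ) := by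
  refine ⟨F.finite_meetingLines.subset F.support_betti_subset, ?_⟩
  let P : Polynomial ℚ := Polynomial.C (F.numFaces 3 / 2 : ℚ) *
      ((Polynomial.X + Polynomial.C 2) * (Polynomial.X + Polynomial.C 1)) -
    Polynomial.C (F.numInteriorFaces 2 : ℚ) * (Polynomial.X + Polynomial.C 1) +
    Polynomial.C (F.numInteriorFaces 1 : ℚ) + Polynomial.C (F.alphaOne : ℚ)
  have hP : ∀ k : ℕ, P.eval (k : ℚ) =
        (F.numFaces 3 : ℚ) * ((k + 2).choose 2 : ℚ) - (F.numInteriorFaces 2 : ℚ) * ((k : ℚ) + 1)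
          + (F.numInteriorFaces 1 : ℚ) + (F.alphaOne : ℚ) := by
    intro k
    simp only [P, Polynomial.eval_add, Polynomial.eval_sub, Polynomial.eval_mul, Polynomial.eval_C,
      Polynomial.eval_X, Nat.cast_choose_two]
    push_cast
    ring
  refine ⟨P, ?_, hP⟩
  -- The extra one makes the degree positive, so that it can be written `j + 1`.
  refine Filter.eventually_atTop.2 ⟨F.meetingLines.ncard + 1, fun k hk => ?_⟩
  obtain ⟨j, rfl⟩ : ∃ j, k = j + 1 := ⟨k - 1, by omega⟩
  have halpha : (F.alphaOne : ℚ) =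
      ((∑ ξ ∈ F.finite_meetingLines.toFinset, F.betti ξ : ℕ) : ℚ) - F.numInteriorFaces 1 := by
    rw [PolyhedralFan.alphaOne, finsum_eq_sum_of_support_subset
      (s := F.finite_meetingLines.toFinset)]
    · push_cast
      rfl
    · rw [Set.Finite.coe_toFinset]
      refine Set.Subset.trans (fun ξ hξ => ?_) F.support_betti_subset
      simpa using hξ
  have h : ((Module.finrank ℚ (F.splinesOfDegree (j + 1)) + F.numInteriorFaces 2 * (j + 3).choose 2 : ℕ)
      : ℚ) = ((F.numFaces 3 * (j + 3).choose 2 + F.numInteriorFaces 2 * (j + 2).choose 2 +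
        ∑ ξ ∈ F.finite_meetingLines.toFinset, F.betti ξ : ℕ) : ℚ) :=
    congrArg _ (PolyhedralFan.finrank_splinesOfDegree_add hF (by omega))
  rw [hP, halpha, show j + 1 + 2 = j + 3 by ring]
  rw [Nat.cast_add, Nat.cast_add, Nat.cast_add, Nat.cast_mul, Nat.cast_mul, Nat.cast_mul] at h
  -- With k = j + 1, the difference of the binomials of j + 3 and j + 2 over 2 is j + 2 = k + 1, the
  -- coefficient of f₂⁰.
  simp only [Nat.cast_choose_two] at h ⊢
  push_cast at h ⊢
  linarith
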